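/- **Setting.** Let $\{\theta_k\}_{k\in\mathbb Z}$ be a strictly increasing sequence of real numbers with $|\theta_k|\to\infty$ as $|k|\to\infty$, $\theta_{-1}<0<\theta_0$, and $\sum_{k\ge 0}(\theta_{2k}-\theta_{2k-1})=\sum_{k\le 0}(\theta_{2k}-\theta_{2k-1})=\infty$. Let $\mathbb T_0=\bigcup_{k\in\mathbb Z}[\theta_{2k-1},\theta_{2k}]$ and $\delta_k=\theta_{2k+1}-\theta_{2k}$. Assume that $\mathbb T_0$ is $\omega$-periodic for some $\omega>0$, i.e. $t\in\mathbb T_0\iff t+\omega\in\mathbb T_0$, and let $p\in\mathbb N$ be the number of intervals per period, i.e. $\theta_{k+2p}=\theta_k+\omega$ for all $k$. Put $\bar\delta=\max_{0\le k\le p-1}\delta_k$, $$\psi(t)=\begin{cases} t-\sum_{0<\theta_{2k}<t}\delta_k, & t\ge 0,\\ t+\sum_{t\le\theta_{2k}<0}\delta_k, & t<0,\end{cases}\qquad s_k=\psi(\theta_{2k}).$$ Let $A$ be a real $n\times n$ matrix, $f:\mathbb T_0\times\mathbb R^n\to\mathbb R^n$ rd-continuous, $\Lambda\subset\mathbb R^n$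 compact and $F:\Lambda\to\Lambda$ continuous. Let $\Theta$ be the set of sequences $\zeta=\{\zeta_k\}_{k\in\mathbb Z}$ in $\Lambda$ with $\zeta_{k+1}=F(\zeta_k)$ for all $k\in\mathbb Z$. For $\zeta\in\Theta$ consider $$y^{\Delta}(t)=Ay(t)+f(t,y(t))+g(t,\zeta),\quad t\in\mathbb T_0,\qquad g(t,\zeta)=\zeta_k\ \text{ for } t\in[\theta_{2k-1},\theta_{2k}].\tag{1}$$ Let $\|\cdot\|$ be the Euclidean norm and the induced matrix norm, and let $X(s,r)$ be the transition matrix of the impulsive system $x'=Ax$ $(s\ne s_k)$, $x(s_k+)-x(s_k)=\delta_kAx(s_k)$, with left-continuous solutions. Assume: * (C1) $\det(I+\delta_kA)\neq0$ for all $k\in\mathbb Z$. * (C2) All eigenvalues of $e^{\psi(\omega)A}\prod_{j=0}^{p-1}(I+\delta_jA)$ lie inside the unit circle. * (C3) There are $M_f,M_F>0$ with $\|f(t,y)\|\le M_f$ for all $t\in\mathbb T_0$, $y\in\mathbb R^n$, and $\|F(\eta)\|\le M_F$ for all $\eta\in\Lambda$. * (C4) There is $L_f>0$ with $\|f(t,y_1)-f(t,y_2)\|\le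 L_f\|y_1-y_2\|$ for all $t\in\mathbb T_0$, $y_1,y_2\in\mathbb R^n$. Let $N,\lambda>0$ be numbers with $\|X(s,r)\|\le Ne^{-\lambda(s-r)}$ for all $s\ge r$, and assume further: * (C5) $NL_f\Big(\frac1\lambda+\frac{p\bar\delta}{1-e^{-\lambda\psi(\omega)}}\Big)<1$. * (C6) $-\lambda+NL_f+\frac{p}{\psi(\omega)}\ln(1+NL_f\bar\delta)<0$. **Statement.** Let $\zeta,\tilde\zeta\in\Theta$ be proximal, i.e. $\liminf_{k\to\infty}\|\zeta_k-\tilde\zeta_k\|=0$. Then the unique solutions $\varphi_\zeta$, $\varphi_{\tilde\zeta}$ of (1), for $\zeta$ and $\tilde\zeta$ respectively, that are bounded on $\mathbb T_0$ (they exist and are unique) are proximal: for every $\varepsilon>0$ and every $E\in\mathbb N$ there is an integer $m$ such that $$\|\varphi_\zeta(t)-\varphi_{\tilde\zeta}(t)\|<\varepsilon\quad\text{for all } t\in[\theta_{2m-1},\theta_{2(m+E)}]\cap\mathbb T_0 .$$ -/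

import Mathlib

open Set Filter Topology

noncomputable section

/-! ## Time scales -/

/-- The forward jump operator `σ(t) = inf {s ∈ T : s > t}` of a time scale `T`. -/
def fwdJump (T : Set ℝ) (t : ℝ) : ℝ := sInf {s | s ∈ T ∧ t < s}

/-- The backward jump operator `ρ(t) = sup {s ∈ T : s < t}` of a time scale `T`. -/
def bwdJump (T : Set ℝ) (t : ℝ) : ℝ := sSup {s | s ∈ T ∧ s < t}

/-- `y` is continuous at the point `t` of the time scale `T` and its `Δ`-derivative there is `v`:
the difference quotient over the jump at a right-scattered point, the limit of the difference
quotients (taken inside `T`) at a right-dense point. -/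
def HasDeltaDerivAt {V : Type*} [NormedAddCommGroup V] [NormedSpace ℝ V]
    (T : Set ℝ) (y : ℝ → V) (v : V) (t : ℝ) : Prop :=
  ContinuousWithinAt y T t ∧
    (t < fwdJump T t → v = (fwdJump T t - t)⁻¹ • (y (fwdJump T t) - y t)) ∧
    (fwdJump T t = t → HasDerivWithinAt y v T t)

/-- Rd-continuity of `h : T × V → V`; only the values `h t u` with `t ∈ T` matter. -/
def RdContinuous {V : Type*} [NormedAddCommGroup V] [NormedSpace ℝ V]
    (T : Set ℝ) (h : ℝ → V → V) : Prop :=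
  (∀ t ∈ T, fwdJump T t = t → ∀ u : V,
      ContinuousWithinAt (Function.uncurry h) (T ×ˢ univ) (t, u)) ∧
  (∀ t ∈ T, bwdJump T t = t → ∀ u : V,
      (∃ l : V, Tendsto (Function.uncurry h) (𝓝[T ∩ Iio t] t ×ˢ 𝓝 u) (𝓝 l)) ∧
      Tendsto (h t) (𝓝 u) (𝓝 (h t u)))

/-- The data of a time scale of the form `⋃ₖ [θ_{2k-1}, θ_{2k}]`, `k ∈ ℤ`. -/
structure IntervalTimeScale where
  θ : ℤ → ℝ
  strictMono : StrictMono θ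
  /-- `|θ_k| → ∞` as `|k| → ∞`. -/
  tendsto_abs : Tendsto (fun k => |θ k|) cofinite atTop
  sum_right : Tendsto (fun n : ℕ => ∑ k ∈ Finset.range n,
    (θ (2 * (k : ℤ)) - θ (2 * (k : ℤ) - 1))) atTop atTop
  sum_left : Tendsto (fun n : ℕ => ∑ k ∈ Finset.range n,
    (θ (2 * (-(k : ℤ))) - θ (2 * (-(k : ℤ)) - 1))) atTop atTop
  neg_one_neg : θ (-1) < 0
  zero_pos : 0 < θ 0

namespace IntervalTimeScale

variable (T : IntervalTimeScale)

/-- The time scale `𝕋₀ = ⋃ₖ [θ_{2k-1}, θ_{2k}]`. -/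
def carrier : Set ℝ := ⋃ k : ℤ, Icc (T.θ (2 * k - 1)) (T.θ (2 * k))

/-- The gap lengths `δ_k = θ_{2k+1} - θ_{2k}`. -/
def δ (k : ℤ) : ℝ := T.θ (2 * k + 1) - T.θ (2 * k)

/-- The substitution `ψ`, which removes the gaps. The sums are finite. -/
def ψ (t : ℝ) : ℝ :=
  if 0 ≤ t then t - ∑ᶠ k ∈ {k : ℤ | 0 < T.θ (2 * k) ∧ T.θ (2 * k) < t}, T.δ k
  else t + ∑ᶠ k ∈ {k : ℤ | t ≤ T.θ (2 * k) ∧ T.θ (2 * k) < 0}, T.δ k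

/-- The impulse moments `s_k = ψ(θ_{2k})`. -/
def s (k : ℤ) : ℝ := T.ψ (T.θ (2 * k))

/-- `𝕋₀ + ω = 𝕋₀`. -/
def OmegaProperty (ω : ℝ) : Prop := ∀ t : ℝ, t ∈ T.carrier ↔ t + ω ∈ T.carrier

/-- `p` is the number of the intervals `[θ_{2k-1}, θ_{2k}]` in one period `ω`. -/
def IsPeriodCount (ω : ℝ) (p : ℕ) : Prop :=
  0 < p ∧ ∀ k : ℤ, T.θ (k + 2 * (p : ℤ)) = T.θ k + ω

/-- `δ̄ = max_{0 ≤ k ≤ p-1} δ_k`. -/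
def δmax (p : ℕ) : ℝ := ⨆ k : Fin p, T.δ (k : ℤ)

/-- The product of the (commuting) matrices `I + δ_k A`, `k ∈ S`. -/
def impulseProd {n : ℕ} (A : Matrix (Fin n) (Fin n) ℝ) (S : Finset ℤ) :
    Matrix (Fin n) (Fin n) ℝ :=
  S.noncommProd (fun k => 1 + T.δ k • A) (fun i _ j _ _ => by
    have h : Commute (T.δ i • A) (T.δ j • A) := ((Commute.refl A).smul_left _).smul_right _
    exact ((Commute.one_left _).add_left ((Commute.one_right _).add_right h)))

/-- The impulse indices `k` with `r ≤ s_k < s`; this set is finite for all real `r`, `s`. -/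
def impulseIndices (r s : ℝ) : Finset ℤ :=
  open Classical in
  if h : {k : ℤ | r ≤ T.s k ∧ T.s k < s}.Finite then h.toFinset else ∅

/-- The transition matrix `X(s, r)`, `r ≤ s`, of the linear impulsive system `x' = A x` for
`s ≠ s_k`, `x(s_k+) - x(s_k) = δ_k A x(s_k)` with left-continuous solutions: it is the product
of the flows `e^{τ A}` over the impulse-free pieces of `[r, s]` and of the jumps `I + δ_k A`,
`r ≤ s_k < s`. As all these factors commute, the flows collect to `e^{(s-r) A}`. -/
def transition {n : ℕ} (A : Matrix (Fin n) (Fin n) ℝ) (s r : ℝ) : Matrix (Fin n) (Fin n) ℝ :=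
  NormedSpace.exp ((s - r) • A) * T.impulseProd A (T.impulseIndices r s)

/-- `y` is a solution on `𝕋₀` of `y^Δ(t) = A y(t) + f(t, y(t)) + g(t, ζ)`, where
`g(t, ζ) = ζ_k` for `t ∈ [θ_{2k-1}, θ_{2k}]`. -/
def IsSolution {n : ℕ} (A : Matrix (Fin n) (Fin n) ℝ)
    (f : ℝ → EuclideanSpace ℝ (Fin n) → EuclideanSpace ℝ (Fin n))
    (ζ : ℤ → EuclideanSpace ℝ (Fin n)) (y : ℝ → EuclideanSpace ℝ (Fin n)) : Prop :=
  ∀ k : ℤ, ∀ t ∈ Icc (T.θ (2 * k - 1)) (T.θ (2 * k)),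
    HasDeltaDerivAt T.carrier y
      (Matrix.toEuclideanCLM (𝕜 := ℝ) A (y t) + f t (y t) + ζ k) t

/-- `y` is a solution which is bounded on `𝕋₀`. -/
def IsBoundedSolution {n : ℕ} (A : Matrix (Fin n) (Fin n) ℝ)
    (f : ℝ → EuclideanSpace ℝ (Fin n) → EuclideanSpace ℝ (Fin n))
    (ζ : ℤ → EuclideanSpace ℝ (Fin n)) (y : ℝ → EuclideanSpace ℝ (Fin n)) : Prop :=
  T.IsSolution A f ζ y ∧ ∃ K : ℝ, ∀ t ∈ T.carrier, ‖y t‖ ≤ K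

/-- `y` is the unique solution bounded on `𝕋₀` (uniqueness as a function on `𝕋₀`). -/
def IsUniqueBoundedSolution {n : ℕ} (A : Matrix (Fin n) (Fin n) ℝ)
    (f : ℝ → EuclideanSpace ℝ (Fin n) → EuclideanSpace ℝ (Fin n))
    (ζ : ℤ → EuclideanSpace ℝ (Fin n)) (y : ℝ → EuclideanSpace ℝ (Fin n)) : Prop :=
  T.IsBoundedSolution A f ζ y ∧
    ∀ z, T.IsBoundedSolution A f ζ z → EqOn z y T.carrier

/-- Proximality of a pair of functions on `𝕋₀`. -/
def Proximal {V : Type*} [NormedAddCommGroup V] (y z : ℝ → V) : Prop :=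
  ∀ ε : ℝ, 0 < ε → ∀ E : ℕ, ∃ m : ℤ,
    ∀ t ∈ Icc (T.θ (2 * m - 1)) (T.θ (2 * (m + (E : ℤ)))) ∩ T.carrier, ‖y t - z t‖ < ε

end IntervalTimeScale

/-- The set of all two-sided sequences in `Λ` generated by `ζ_{k+1} = F(ζ_k)`. -/
def generatedSeqs {V : Type*} (F : V → V) (Λ : Set V) : Set (ℤ → V) :=
  {ζ | ∀ k : ℤ, ζ k ∈ Λ ∧ ζ (k + 1) = F (ζ k)}

/-- Proximality of a pair of sequences. -/
def SeqProximal {V : Type*} [NormedAddCommGroup V] (ζ ζ' : ℤ → V) : Prop :=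
  liminf (fun k : ℤ => ‖ζ k - ζ' k‖) atTop = 0

end

open Set Filter Topology

noncomputable section

/-! ### Impulse moments and periodicity after the gaps are removed. -/

namespace IntervalTimeScale

variable (T : IntervalTimeScale)

/-! The equation forgets its past at a uniform exponential rate, so two bounded solutions come close
wherever their forcings have stayed close long enough.

Let `D` be the difference of two solutions. On the `k`-th interval `D' = A D + r` with `‖r‖ ≤ L_f
‖D‖ + ε`, where `ε` bounds `‖ζ k - ζ' k‖`, and the gap adds `δ_k (A D + r)`. Iterating the bound on
`X` would cost a factor `N` per interval. Instead a state right after `s_{k-1}` is measured by the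
constants `U` for which its whole linear future is at most `U e^{-λ(s - s_{k-1})}` (`DecayBound`).
This size lies between `‖x‖` and `N ‖x‖`, and the linear flow decreases it with no loss. By
Gronwall, an interval of length `ℓ` then costs `e^{(N L_f - λ) ℓ}` and a gap `1 + N L_f δ̄`
(`interval_estimate`, `decayBound_jump`).

A single long interval may expand, and (C6) gives contraction only on average. Bounded weights
(`exists_weight`) replace every length by the mean `ψ(ω)/p`, so each step has the same factor `κ <
1`, plus a multiple of `ε`: this is `ContractionEstimate`.

The rest uses only this estimate. Pulling back from the distant past produces a bounded solution,
and the contraction makes it unique. If `ζ` and `ζ'` are close at one index, uniform continuity of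
`F` keeps them close for `J + E` further indices: the first `J` wipe out the old difference of the
solutions, and the others form the required window. -/

theorem zero_lt_θ_iff (k : ℤ) : 0 < T.θ (2 * k) ↔ 0 ≤ k := by
  constructor
  · intro h
    by_contra! hk
    have := T.strictMono.monotone (show 2 * k ≤ -1 by omega)
    linarith [T.neg_one_neg]
  · intro h
    have := T.strictMono.monotone (show 0 ≤ 2 * k by omega)
    linarith [T.zero_pos]

theorem θ_neg_iff (k : ℤ) : T.θ (2 * k) < 0 ↔ k < 0 := by
  constructor
  · intro h
    by_contra! hk
    linarith [(T.zero_lt_θ_iff k).2 hk]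
  · intro h
    have := T.strictMono.monotone (show 2 * k ≤ -1 by omega)
    linarith [T.neg_one_neg]

theorem θ_even_lt_iff (j k : ℤ) : T.θ (2 * j) < T.θ (2 * k) ↔ j < k := by
  rw [T.strictMono.lt_iff_lt]; omega

theorem s_of_nonneg {k : ℤ} (hk : 0 ≤ k) :
    T.s k = T.θ (2 * k) - ∑ j ∈ Finset.Ico 0 k, T.δ j := by
  have h : {j : ℤ | 0 < T.θ (2 * j) ∧ T.θ (2 * j) < T.θ (2 * k)} = ↑(Finset.Ico 0 k) := by
    ext j
    simp [zero_lt_θ_iff, θ_even_lt_iff]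
  rw [s, ψ, if_pos ((T.zero_lt_θ_iff k).2 hk).le, h, finsum_mem_coe_finset]

theorem s_of_neg {k : ℤ} (hk : k < 0) :
    T.s k = T.θ (2 * k) + ∑ j ∈ Finset.Ico k 0, T.δ j := by
  have h : {j : ℤ | T.θ (2 * k) ≤ T.θ (2 * j) ∧ T.θ (2 * j) < 0} = ↑(Finset.Ico k 0) := by
    ext j
    have h1 : T.θ (2 * k) ≤ T.θ (2 * j) ↔ k ≤ j := by
      rw [← not_lt, T.θ_even_lt_iff, not_lt]
    simp only [mem_ofPred_eq, h1, θ_neg_iff, Finset.coe_Ico, mem_Ico]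
  rw [s, ψ, if_neg (not_le.2 ((T.θ_neg_iff k).2 hk)), h, finsum_mem_coe_finset]

theorem s_succ_sub (k : ℤ) : T.s (k + 1) - T.s k = T.θ (2 * k + 2) - T.θ (2 * k + 1) := by
  have e : 2 * (k + 1) = 2 * k + 2 := by ring
  rcases lt_trichotomy k (-1) with h | h | h
  · rw [s_of_neg T (show k + 1 < 0 by omega), s_of_neg T (show k < 0 by omega)]
    have : Finset.Ico k 0 = insert k (Finset.Ico (k + 1) 0) := by
      ext j; simp; omega
    rw [this, Finset.sum_insert (by simp), e, δ]
    ring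
  · subst h
    rw [s_of_nonneg T (by norm_num), s_of_neg T (by norm_num)]
    have : Finset.Ico (-1 : ℤ) 0 = {-1} := by decide
    simp [this, δ]
  · rw [s_of_nonneg T (show 0 ≤ k + 1 by omega), s_of_nonneg T (show 0 ≤ k by omega)]
    have : Finset.Ico 0 (k + 1) = insert k (Finset.Ico 0 k) := by
      ext j; simp; omega
    rw [this, Finset.sum_insert (by simp), e, δ]
    ring

theorem s_sub_pred (k : ℤ) : T.s k - T.s (k - 1) = T.θ (2 * k) - T.θ (2 * k - 1) := by
  have := T.s_succ_sub (k - 1)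
  convert this using 3 <;> ring_nf

theorem s_strictMono : StrictMono T.s := by
  refine strictMono_int_of_lt_succ fun k => ?_
  have := T.s_succ_sub k
  have h := T.strictMono (show 2 * k + 1 < 2 * k + 2 by omega)
  linarith

theorem δ_pos (k : ℤ) : 0 < T.δ k := sub_pos.2 (T.strictMono (by omega))

variable {T} {ω : ℝ} {p : ℕ}

theorem IsPeriodCount.ψ_eq (hω : 0 < ω) (hp : T.IsPeriodCount ω p) :
    T.ψ ω = ω - ∑ j ∈ Finset.Ico 0 (p : ℤ), T.δ j := by
  obtain ⟨hp0, hper⟩ := hp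
  have h : {j : ℤ | 0 < T.θ (2 * j) ∧ T.θ (2 * j) < ω} = ↑(Finset.Ico 0 (p : ℤ)) := by
    ext j
    simp only [mem_ofPred_eq, zero_lt_θ_iff, Finset.coe_Ico, mem_Ico, and_congr_right_iff]
    intro hj
    constructor
    · intro h
      by_contra! hk
      have h1 := T.strictMono.monotone (show 0 + 2 * (p : ℤ) ≤ 2 * j by omega)
      rw [hper 0] at h1
      linarith [T.zero_pos]
    · intro h
      have h1 := T.strictMono.monotone (show 2 * j ≤ -1 + 2 * (p : ℤ) by omega)
      rw [hper (-1)] at h1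
      linarith [T.neg_one_neg]
  rw [ψ, if_pos hω.le, h, finsum_mem_coe_finset]

theorem IsPeriodCount.s_add (hω : 0 < ω) (hp : T.IsPeriodCount ω p) (k : ℤ) :
    T.s (k + p) = T.s k + T.ψ ω := by
  have step (k : ℤ) : T.s (k + 1 + p) - T.s (k + 1) = T.s (k + p) - T.s k := by
    have h1 := T.s_succ_sub k
    have h2 := T.s_succ_sub (k + p)
    have h3 := hp.2 (2 * k + 2)
    have h4 := hp.2 (2 * k + 1)
    rw [show 2 * (k + (p : ℤ)) + 2 = 2 * k + 2 + 2 * p by ring,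
      show 2 * (k + (p : ℤ)) + 1 = 2 * k + 1 + 2 * p by ring, h3, h4,
      show k + (p : ℤ) + 1 = k + 1 + p by ring] at h2
    linarith
  have base : T.s (0 + p) - T.s 0 = T.ψ ω := by
    have h := hp.2 0
    rw [zero_add] at h
    rw [zero_add, s_of_nonneg T (by omega), s_of_nonneg T le_rfl, hp.ψ_eq hω, h]
    simp
    ring
  have key : T.s (k + p) - T.s k = T.ψ ω := by
    induction k using Int.induction_on with
    | zero => exact base
    | succ i ih => rw [step, ih]
    | pred i ih => rw [← ih, ← step, sub_add_cancel]
  linarith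

theorem IsPeriodCount.ψ_pos (hω : 0 < ω) (hp : T.IsPeriodCount ω p) : 0 < T.ψ ω := by
  have h1 := hp.s_add hω 0
  have h2 := T.s_strictMono (show (0 : ℤ) < 0 + p by have := hp.1; omega)
  linarith

theorem IsPeriodCount.s_add_mul (hω : 0 < ω) (hp : T.IsPeriodCount ω p) (k m : ℤ) :
    T.s (k + m * p) = T.s k + m * T.ψ ω := by
  induction m using Int.induction_on with
  | zero => simp
  | succ i ih =>
    rw [show k + ((i : ℤ) + 1) * p = k + i * p + p by ring, hp.s_add hω, ih]
    push_cast; ring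
  | pred i ih =>
    have := hp.s_add hω (k + (-(i : ℤ) - 1) * p)
    rw [show k + (-(i : ℤ) - 1) * p + p = k + -(i : ℤ) * p by ring, ih] at this
    push_cast at this ⊢
    linarith

/-- `impulseIndices` takes the default value `∅` on infinite sets, so its membership rule depends on
this finiteness. -/
theorem IsPeriodCount.finite_impulses (hω : 0 < ω) (hp : T.IsPeriodCount ω p) (r s' : ℝ) :
    {k : ℤ | r ≤ T.s k ∧ T.s k < s'}.Finite := by
  have hψ := hp.ψ_pos hω
  obtain ⟨m, hm⟩ := exists_nat_gt ((s' - T.s 0) / T.ψ ω)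
  obtain ⟨m', hm'⟩ := exists_nat_gt ((T.s 0 - r) / T.ψ ω)
  rw [div_lt_iff₀ hψ] at hm hm'
  have h1 := hp.s_add_mul hω 0 m
  have h2 := hp.s_add_mul hω 0 (-m')
  push_cast at h1 h2
  refine (finite_Icc (0 + -(m' : ℤ) * p) (0 + (m : ℤ) * p)).subset fun k hk => ⟨?_, ?_⟩
  · refine (T.s_strictMono.lt_iff_lt.1 ?_).le
    linarith [hk.1]
  · refine (T.s_strictMono.lt_iff_lt.1 ?_).le
    linarith [hk.2]

theorem IsPeriodCount.mem_impulseIndices (hω : 0 < ω) (hp : T.IsPeriodCount ω p) {r s' : ℝ}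
    {k : ℤ} : k ∈ T.impulseIndices r s' ↔ r ≤ T.s k ∧ T.s k < s' := by
  rw [impulseIndices, dif_pos (hp.finite_impulses hω r s')]
  simp

theorem eq_emod_of_add_eq {α : Type*} {u : ℤ → α} {p : ℕ} (h : ∀ k, u (k + p) = u k) (k : ℤ) :
    u k = u (k % p) := by
  have key (m k : ℤ) : u (k + m * p) = u k := by
    induction m using Int.induction_on with
    | zero => simp
    | succ i ih => rw [show k + ((i : ℤ) + 1) * p = k + i * p + p by ring, h, ih]
    | pred i ih => rw [← ih, ← h, show k + (-(i : ℤ) - 1) * p + p = k + -(i : ℤ) * p by ring]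
  rw [← key (k / p) (k % p)]
  congr 1
  have := Int.emod_add_mul_ediv k p
  linarith

theorem IsPeriodCount.δ_add (hp : T.IsPeriodCount ω p) (k : ℤ) : T.δ (k + p) = T.δ k := by
  rw [δ, δ, show 2 * (k + (p : ℤ)) + 1 = 2 * k + 1 + 2 * p by ring,
    show 2 * (k + (p : ℤ)) = 2 * k + 2 * p by ring, hp.2, hp.2]
  ring

theorem IsPeriodCount.δ_le (hp : T.IsPeriodCount ω p) (k : ℤ) : T.δ k ≤ T.δmax p := by
  have hp0 : (0 : ℤ) < p := by exact_mod_cast hp.1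
  rw [eq_emod_of_add_eq hp.δ_add k]
  have h0 := Int.emod_nonneg k hp0.ne'
  have h1 := Int.emod_lt_of_pos k hp0
  have := le_ciSup (f := fun k : Fin p => T.δ (k : ℤ)) (Set.finite_range _).bddAbove
    ⟨(k % p).toNat, by omega⟩
  simpa [δmax, Int.toNat_of_nonneg h0] using this

/-- The deviation of `s_k` from its mean growth is `p`-periodic in `k`. It provides the weights of
`exists_weight`. -/
theorem IsPeriodCount.exists_abs_s_sub_le (hω : 0 < ω) (hp : T.IsPeriodCount ω p) :
    ∃ B, ∀ k : ℤ, |T.s k - k * (T.ψ ω / p)| ≤ B := by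
  have hp0 : (0 : ℤ) < p := by exact_mod_cast hp.1
  have hp0' : (p : ℝ) ≠ 0 := by exact_mod_cast hp.1.ne'
  refine ⟨∑ k ∈ Finset.Ico 0 (p : ℤ), |T.s k - k * (T.ψ ω / p)|, fun k => ?_⟩
  have h := eq_emod_of_add_eq (u := fun k : ℤ => |T.s k - k * (T.ψ ω / p)|) (p := p) (fun k => by
    simp only [hp.s_add hω]
    congr 1
    push_cast
    field_simp
    ring) k
  refine h.le.trans ?_
  exact Finset.single_le_sum (f := fun k : ℤ => |T.s k - k * (T.ψ ω / p)|)
    (fun _ _ => abs_nonneg _)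
    (Finset.mem_Ico.2 ⟨Int.emod_nonneg k hp0.ne', Int.emod_lt_of_pos k hp0⟩)

theorem IsPeriodCount.length_le (hp : T.IsPeriodCount ω p) (k : ℤ) :
    T.θ (2 * k) - T.θ (2 * k - 1) ≤ ω := by
  have h := hp.2 (2 * k - 1)
  have := T.strictMono.monotone (show 2 * k ≤ 2 * k - 1 + 2 * p by have := hp.1; omega)
  linarith

end IntervalTimeScale

/-! ### The linear impulsive system and its decay. -/

theorem continuous_exp_smul {𝔸 : Type*} [NormedRing 𝔸] [NormedAlgebra ℝ 𝔸] [CompleteSpace 𝔸]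
    (B : 𝔸) : Continuous fun t : ℝ => NormedSpace.exp (t • B) :=
  continuous_iff_continuousAt.2 fun t => (hasDerivAt_exp_smul_const B t).continuousAt

theorem commute_exp_smul {𝔸 : Type*} [NormedRing 𝔸] [NormedAlgebra ℝ 𝔸] [CompleteSpace 𝔸]
    {B Q : 𝔸} (h : Commute B Q) (t : ℝ) : Commute (NormedSpace.exp (t • B)) Q := by
  let _ : NormedAlgebra ℚ 𝔸 := .restrictScalars ℚ ℝ 𝔸
  exact (h.smul_left t).exp_left

theorem commute_one_add_smul_exp_smul {𝔸 : Type*} [NormedRing 𝔸] [NormedAlgebra ℝ 𝔸]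
    [CompleteSpace 𝔸] (B : 𝔸) (c t : ℝ) :
    Commute (1 + c • B) (NormedSpace.exp (t • B)) :=
  (commute_exp_smul ((Commute.one_right B).add_right ((Commute.refl B).smul_right c)) t).symm

theorem exp_zero_smul {E : Type*} [NormedAddCommGroup E] [NormedSpace ℝ E] (B : E →L[ℝ] E) :
    NormedSpace.exp ((0 : ℝ) • B) = 1 := by
  rw [zero_smul, NormedSpace.exp_zero]

namespace IntervalTimeScale

variable {T : IntervalTimeScale} {ω : ℝ} {p n : ℕ}

variable (T) in
/-- The product of the jumps `I + δ_j A` over `s_k ≤ s_j < s'`, as an operator. -/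
def tailProd (A : Matrix (Fin n) (Fin n) ℝ) (k : ℤ) (s' : ℝ) :
    EuclideanSpace ℝ (Fin n) →L[ℝ] EuclideanSpace ℝ (Fin n) :=
  Matrix.toEuclideanCLM (𝕜 := ℝ) (T.impulseProd A (T.impulseIndices (T.s k) s'))

theorem IsPeriodCount.tailProd_of_le (hω : 0 < ω) (hp : T.IsPeriodCount ω p)
    (A : Matrix (Fin n) (Fin n) ℝ) {k : ℤ} {s' : ℝ} (h : s' ≤ T.s k) :
    T.tailProd A k s' = 1 := by
  have : T.impulseIndices (T.s k) s' = ∅ := by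
    ext j
    simp only [hp.mem_impulseIndices hω, Finset.notMem_empty, iff_false, not_and, not_lt]
    intro hj
    linarith
  simp only [tailProd, impulseProd, this]
  exact (congrArg _ (Finset.noncommProd_empty _ _)).trans (map_one _)

theorem IsPeriodCount.tailProd_of_lt (hω : 0 < ω) (hp : T.IsPeriodCount ω p)
    (A : Matrix (Fin n) (Fin n) ℝ) {k : ℤ} {s' : ℝ} (h : T.s k < s') :
    T.tailProd A k s' =
      T.tailProd A (k + 1) s' * (1 + T.δ k • Matrix.toEuclideanCLM (𝕜 := ℝ) A) := by
  classical
  have : T.impulseIndices (T.s k) s' = insert k (T.impulseIndices (T.s (k + 1)) s') := by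
    ext j
    simp only [hp.mem_impulseIndices hω, Finset.mem_insert, T.s_strictMono.le_iff_le]
    constructor
    · rintro ⟨h1, h2⟩
      rcases h1.eq_or_lt with rfl | h1
      · exact Or.inl rfl
      · exact Or.inr ⟨by omega, h2⟩
    · rintro (rfl | ⟨h1, h2⟩)
      · exact ⟨le_rfl, h⟩
      · exact ⟨by omega, h2⟩
  have hk : k ∉ T.impulseIndices (T.s (k + 1)) s' := by
    simp [hp.mem_impulseIndices hω, T.s_strictMono.le_iff_le]
  simp only [tailProd, impulseProd, this]
  rw [Finset.noncommProd_insert_of_notMem' _ _ _ _ hk, map_mul, map_add, map_one, map_smul]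

theorem toEuclideanCLM_exp (M : Matrix (Fin n) (Fin n) ℝ) :
    Matrix.toEuclideanCLM (𝕜 := ℝ) (NormedSpace.exp M) =
      NormedSpace.exp (Matrix.toEuclideanCLM (𝕜 := ℝ) M) := by
  have hc : Continuous (Matrix.toEuclideanCLM (𝕜 := ℝ) (n := Fin n)) :=
    LinearMap.continuous_of_finiteDimensional
      (Matrix.toEuclideanCLM (𝕜 := ℝ) (n := Fin n)).toAlgEquiv.toLinearMap
  open scoped Matrix.Norms.Operator in
  exact NormedSpace.map_exp (Matrix.toEuclideanCLM (𝕜 := ℝ) (n := Fin n)) hc M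

theorem IsPeriodCount.toEuclideanCLM_transition (hω : 0 < ω) (hp : T.IsPeriodCount ω p)
    (A : Matrix (Fin n) (Fin n) ℝ) {k : ℤ} {r s' : ℝ} (h1 : T.s (k - 1) < r) (h2 : r ≤ T.s k) :
    Matrix.toEuclideanCLM (𝕜 := ℝ) (T.transition A s' r) =
      T.tailProd A k s' * NormedSpace.exp ((s' - r) • Matrix.toEuclideanCLM (𝕜 := ℝ) A) := by
  have : T.impulseIndices r s' = T.impulseIndices (T.s k) s' := by
    ext j
    simp only [hp.mem_impulseIndices hω, T.s_strictMono.le_iff_le, and_congr_left_iff]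
    intro _
    constructor
    · intro h
      have := T.s_strictMono.lt_iff_lt.1 (h1.trans_le h)
      omega
    · intro h
      exact h2.trans (T.s_strictMono.monotone h)
  have hc : Commute (Matrix.toEuclideanCLM (𝕜 := ℝ) A) (T.tailProd A k s') := by
    refine Commute.map (Finset.noncommProd_commute _ _ _ _ fun j _ => ?_) _
    exact (Commute.one_right A).add_right ((Commute.refl A).smul_right _)
  rw [transition, this, map_mul, toEuclideanCLM_exp, map_smul]
  exact commute_exp_smul hc _

theorem IsPeriodCount.norm_tailProd_mul_exp_le (hω : 0 < ω) (hp : T.IsPeriodCount ω p)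
    {A : Matrix (Fin n) (Fin n) ℝ} {N lam : ℝ}
    (hX : ∀ s r : ℝ, r ≤ s →
      ‖Matrix.toEuclideanCLM (𝕜 := ℝ) (T.transition A s r)‖ ≤ N * Real.exp (-lam * (s - r)))
    {k : ℤ} {r s' : ℝ} (h1 : T.s (k - 1) ≤ r) (h2 : r ≤ T.s k) (h3 : r ≤ s')
    (h4 : T.s (k - 1) < s') :
    ‖T.tailProd A k s' * NormedSpace.exp ((s' - r) • Matrix.toEuclideanCLM (𝕜 := ℝ) A)‖ ≤
      N * Real.exp (-lam * (s' - r)) := by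
  rcases h1.lt_or_eq with h1 | rfl
  · rw [← hp.toEuclideanCLM_transition hω A h1 h2]
    exact hX _ _ h3
  -- At `r = s_{k-1}` the transition matrix contains the jump at `s_{k-1}`, which is absent here;
  -- the bound is the limit from the right, where that jump has already passed.
  · have hs : T.s (k - 1) < T.s k := T.s_strictMono (by omega)
    have hexp : Continuous fun r : ℝ =>
        NormedSpace.exp ((s' - r) • Matrix.toEuclideanCLM (𝕜 := ℝ) A) :=
      (continuous_exp_smul (Matrix.toEuclideanCLM (𝕜 := ℝ) A)).comp
        (by fun_prop : Continuous fun r : ℝ => s' - r)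
    have hl : Continuous fun r : ℝ => ‖T.tailProd A k s' *
        NormedSpace.exp ((s' - r) • Matrix.toEuclideanCLM (𝕜 := ℝ) A)‖ := by fun_prop
    have hr : Continuous fun r : ℝ => N * Real.exp (-lam * (s' - r)) := by fun_prop
    refine le_of_tendsto_of_tendsto (b := 𝓝[>] T.s (k - 1)) (hl.tendsto _ |>.mono_left inf_le_left)
      (hr.tendsto _ |>.mono_left inf_le_left) ?_
    filter_upwards [Ioo_mem_nhdsGT (lt_min hs h4)] with r hr
    rw [← hp.toEuclideanCLM_transition hω A hr.1 (hr.2.le.trans (min_le_left _ _))]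
    exact hX _ _ (hr.2.le.trans (min_le_right _ _))

/-- `x` decays along the linear impulsive system started right after `s_{k-1}`, with constant
`U`. -/
def DecayBound (T : IntervalTimeScale) (A : Matrix (Fin n) (Fin n) ℝ) (lam : ℝ) (k : ℤ)
    (x : EuclideanSpace ℝ (Fin n)) (U : ℝ) : Prop :=
  ∀ s', T.s (k - 1) < s' → ‖(T.tailProd A k s' *
    NormedSpace.exp ((s' - T.s (k - 1)) • Matrix.toEuclideanCLM (𝕜 := ℝ) A)) x‖ ≤
      U * Real.exp (-lam * (s' - T.s (k - 1)))

theorem DecayBound.mono {A : Matrix (Fin n) (Fin n) ℝ} {lam : ℝ} {k : ℤ}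
    {x : EuclideanSpace ℝ (Fin n)} {U U' : ℝ} (h : T.DecayBound A lam k x U) (hU : U ≤ U') :
    T.DecayBound A lam k x U' := fun s' hs' => (h s' hs').trans (by gcongr)

theorem DecayBound.add {A : Matrix (Fin n) (Fin n) ℝ} {lam : ℝ} {k : ℤ}
    {x y : EuclideanSpace ℝ (Fin n)} {U V : ℝ} (h : T.DecayBound A lam k x U)
    (h' : T.DecayBound A lam k y V) : T.DecayBound A lam k (x + y) (U + V) := by
  intro s' hs'
  rw [map_add, add_mul]
  exact norm_add_le_of_le (h s' hs') (h' s' hs')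

theorem IsPeriodCount.decayBound (hω : 0 < ω) (hp : T.IsPeriodCount ω p)
    {A : Matrix (Fin n) (Fin n) ℝ} {N lam : ℝ}
    (hX : ∀ s r : ℝ, r ≤ s →
      ‖Matrix.toEuclideanCLM (𝕜 := ℝ) (T.transition A s r)‖ ≤ N * Real.exp (-lam * (s - r)))
    (k : ℤ) (x : EuclideanSpace ℝ (Fin n)) : T.DecayBound A lam k x (N * ‖x‖) := by
  intro s' hs'
  refine (ContinuousLinearMap.le_opNorm _ _).trans ?_
  rw [mul_right_comm]
  gcongr
  exact hp.norm_tailProd_mul_exp_le hω hX le_rfl (T.s_strictMono.monotone (by omega)) hs'.le hs'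

end IntervalTimeScale

/-- Variation of constants: in the derivative of `Q e^{(τ - (t - a))B} D(t)` the terms with `B`
cancel and only `Q e^{(τ - (t - a))B} r(t)` remains. Its norm is at most the derivative of `e^{-λτ}
G`. -/
theorem norm_mul_exp_apply_le {E : Type*} [NormedAddCommGroup E] [NormedSpace ℝ E]
    [CompleteSpace E] {B Q : E →L[ℝ] E} {a c τ lam N : ℝ} {D r : ℝ → E} {g G : ℝ → ℝ}
    (hac : a ≤ c) (hD : ContinuousOn D (Icc a c))
    (hD' : ∀ t ∈ Ico a c, HasDerivWithinAt D (B (D t) + r t) (Ici t) t)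
    (hr : ∀ t ∈ Ico a c, ‖r t‖ ≤ g t)
    (hG : ∀ t, HasDerivAt G (N * Real.exp (lam * (t - a)) * g t) t)
    (hQ : ∀ t ∈ Ico a c, ‖Q * NormedSpace.exp ((τ - (t - a)) • B)‖ ≤
      N * Real.exp (-lam * (τ - (t - a))))
    (h0 : ‖(Q * NormedSpace.exp (τ • B)) (D a)‖ ≤ Real.exp (-lam * τ) * G a) :
    ‖(Q * NormedSpace.exp ((τ - (c - a)) • B)) (D c)‖ ≤ Real.exp (-lam * τ) * G c := by
  have hS (t : ℝ) : HasDerivAt (fun t => Q * NormedSpace.exp ((τ - (t - a)) • B))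
      (-(Q * (NormedSpace.exp ((τ - (t - a)) • B) * B))) t := by
    have h1 : HasDerivAt (fun t : ℝ => τ - (t - a)) (-1) t := by
      simpa using ((hasDerivAt_id t).sub_const a).const_sub τ
    have h2 := ((hasDerivAt_exp_smul_const B (τ - (t - a))).scomp t h1).const_mul Q
    simpa using h2
  have key := image_norm_le_of_norm_deriv_right_le_deriv_boundary
    (f := fun t => (Q * NormedSpace.exp ((τ - (t - a)) • B)) (D t))
    (f' := fun t => (Q * NormedSpace.exp ((τ - (t - a)) • B)) (r t)) (a := a) (b := c)
    (B := fun t => Real.exp (-lam * τ) * G t)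
    (B' := fun t => Real.exp (-lam * τ) * (N * Real.exp (lam * (t - a)) * g t))
    ?_ ?_ ?_ (fun t => (hG t).const_mul _) ?_
  · exact key (right_mem_Icc.2 hac)
  · exact ContinuousOn.clm_apply
      (continuous_iff_continuousAt.2 fun t => (hS t).continuousAt).continuousOn hD
  · intro t ht
    have := (hS t).hasDerivWithinAt.clm_apply (hD' t ht)
    convert this using 1
    simp
  · simpa using h0
  · intro t ht
    calc _ ≤ ‖Q * NormedSpace.exp ((τ - (t - a)) • B)‖ * ‖r t‖ := ContinuousLinearMap.le_opNorm _ _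
      _ ≤ (N * Real.exp (-lam * (τ - (t - a)))) * g t :=
        mul_le_mul (hQ t ht) (hr t ht) (norm_nonneg _) ((norm_nonneg _).trans (hQ t ht))
      _ = _ := by
        rw [show -lam * (τ - (t - a)) = -lam * τ + lam * (t - a) by ring, Real.exp_add]
        ring

namespace IntervalTimeScale

variable {T : IntervalTimeScale} {ω : ℝ} {p n : ℕ}

/-- Let `s'` decrease to `s_{k-1}`: before `s_k` there is no jump, and the exponential tends to the
identity. -/
theorem DecayBound.norm_le (hω : 0 < ω) (hp : T.IsPeriodCount ω p)
    {A : Matrix (Fin n) (Fin n) ℝ} {lam : ℝ} {k : ℤ}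
    {x : EuclideanSpace ℝ (Fin n)} {U : ℝ} (h : T.DecayBound A lam k x U) : ‖x‖ ≤ U := by
  have hs : T.s (k - 1) < T.s k := T.s_strictMono (by omega)
  have hexp : Continuous fun r : ℝ =>
      NormedSpace.exp ((r - T.s (k - 1)) • Matrix.toEuclideanCLM (𝕜 := ℝ) A) :=
    (continuous_exp_smul (Matrix.toEuclideanCLM (𝕜 := ℝ) A)).comp
      (by fun_prop : Continuous fun r : ℝ => r - T.s (k - 1))
  have hl : Continuous fun r : ℝ => ‖NormedSpace.exp ((r - T.s (k - 1)) •
      Matrix.toEuclideanCLM (𝕜 := ℝ) A) x‖ := by fun_prop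
  have hr : Continuous fun r : ℝ => U * Real.exp (-lam * (r - T.s (k - 1))) := by fun_prop
  have := le_of_tendsto_of_tendsto (b := 𝓝[>] T.s (k - 1))
    (hl.tendsto _ |>.mono_left inf_le_left) (hr.tendsto _ |>.mono_left inf_le_left) (by
    filter_upwards [Ioo_mem_nhdsGT hs] with r hr
    have := h r hr.1
    rwa [hp.tailProd_of_le hω A hr.2.le, one_mul] at this)
  simpa [-zero_smul, exp_zero_smul] using this

/-- One majorant `G` serves all future times `s'` simultaneously, which is why the conclusion is
again a `DecayBound`. Since `G` dominates `e^{λ(t-a)} ‖D t‖`, it satisfies `G' ≤ N L G + N e^{λω}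
ε`, and Gronwall applies. Lengths are at most `ω`, so the constants do not depend on `k`. -/
theorem IsPeriodCount.interval_estimate (hω : 0 < ω) (hp : T.IsPeriodCount ω p)
    {A : Matrix (Fin n) (Fin n) ℝ} {N lam L : ℝ} (hN : 0 < N) (hlam : 0 < lam) (hL : 0 < L)
    (hX : ∀ s r : ℝ, r ≤ s →
      ‖Matrix.toEuclideanCLM (𝕜 := ℝ) (T.transition A s r)‖ ≤ N * Real.exp (-lam * (s - r)))
    {k : ℤ} {D r : ℝ → EuclideanSpace ℝ (Fin n)} {ε U : ℝ} (hε : 0 ≤ ε)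
    (hD : ContinuousOn D (Icc (T.θ (2 * k - 1)) (T.θ (2 * k))))
    (hD' : ∀ t ∈ Ico (T.θ (2 * k - 1)) (T.θ (2 * k)),
      HasDerivWithinAt D (Matrix.toEuclideanCLM (𝕜 := ℝ) A (D t) + r t) (Ici t) t)
    (hr : ∀ t ∈ Icc (T.θ (2 * k - 1)) (T.θ (2 * k)), ‖r t‖ ≤ L * ‖D t‖ + ε)
    (h0 : T.DecayBound A lam k (D (T.θ (2 * k - 1))) U) :
    ∃ G : ℝ → ℝ, (∀ t ∈ Icc (T.θ (2 * k - 1)) (T.θ (2 * k)),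
        G t ≤ U * Real.exp (N * L * (t - T.θ (2 * k - 1))) +
          Real.exp (lam * ω) / L * Real.exp (N * L * ω) * ε ∧
        ‖D t‖ ≤ Real.exp (-lam * (t - T.θ (2 * k - 1))) * G t) ∧
      T.DecayBound A lam (k + 1)
        (D (T.θ (2 * k)) + T.δ k • (Matrix.toEuclideanCLM (𝕜 := ℝ) A (D (T.θ (2 * k)))))
        (Real.exp (-lam * (T.θ (2 * k) - T.θ (2 * k - 1))) * G (T.θ (2 * k))) := by
  set a := T.θ (2 * k - 1) with ha
  set b := T.θ (2 * k) with hb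
  set B := Matrix.toEuclideanCLM (𝕜 := ℝ) A with hB
  have hab : a < b := T.strictMono (by omega)
  have hlen : T.s k - T.s (k - 1) = b - a := T.s_sub_pred k
  have hbω : b - a ≤ ω := hp.length_le k
  -- Freezing `D` outside `[a, b]` makes `g` continuous on `ℝ`, so the primitive `G` is
  -- differentiable everywhere.
  let g : ℝ → ℝ := fun t => L * ‖D (projIcc a b hab.le t)‖ + ε
  have hg : Continuous g := by
    have : Continuous fun t => D (projIcc a b hab.le t) :=
      (continuousOn_iff_continuous_domRestrict.1 hD).comp continuous_projIcc
    exact (continuous_const.mul this.norm).add continuous_const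
  have hgD : ∀ t ∈ Icc a b, g t = L * ‖D t‖ + ε := fun t ht => by
    simp [g, projIcc_of_mem hab.le ht]
  let G : ℝ → ℝ := fun t => U + ∫ τ in a..t, N * Real.exp (lam * (τ - a)) * g τ
  have hG (t : ℝ) : HasDerivAt G (N * Real.exp (lam * (t - a)) * g t) t := by
    have hc : Continuous fun τ => N * Real.exp (lam * (τ - a)) * g τ := by fun_prop
    exact (intervalIntegral.integral_hasDerivAt_right (hc.intervalIntegrable _ _)
      (hc.stronglyMeasurableAtFilter _ _) hc.continuousAt).const_add U
  have hGa : G a = U := by simp [G]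
  have hrg : ∀ t ∈ Ico a b, ‖r t‖ ≤ g t := fun t ht =>
    (hr t (Ico_subset_Icc_self ht)).trans (hgD t (Ico_subset_Icc_self ht)).ge
  have main (c : ℝ) (hc : c ∈ Icc a b) (s' : ℝ) (hs' : T.s (k - 1) < s')
      (hcs : T.s (k - 1) + (c - a) ≤ s') :
      ‖(T.tailProd A k s' * NormedSpace.exp ((s' - T.s (k - 1) - (c - a)) • B)) (D c)‖ ≤
        Real.exp (-lam * (s' - T.s (k - 1))) * G c := by
    refine norm_mul_exp_apply_le (N := N) (g := g) (r := r) hc.1 (hD.mono (Icc_subset_Icc_right hc.2))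
      (fun t ht => hD' t ⟨ht.1, ht.2.trans_le hc.2⟩)
      (fun t ht => hrg t ⟨ht.1, ht.2.trans_le hc.2⟩) hG (fun t ht => ?_) ?_
    · have := hp.norm_tailProd_mul_exp_le hω hX (k := k) (r := T.s (k - 1) + (t - a)) (s' := s')
        (by linarith [ht.1]) (by linarith [ht.2, hc.2]) (by linarith [ht.2]) hs'
      rwa [← sub_sub] at this
    · rw [hGa, mul_comm]
      exact h0 s' hs'
  have hDG : ∀ t ∈ Icc a b, ‖D t‖ ≤ Real.exp (-lam * (t - a)) * G t := by
    intro t ht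
    rcases ht.1.eq_or_lt with rfl | hat
    · simpa [hGa] using h0.norm_le hω hp
    · have := main t ht (T.s (k - 1) + (t - a)) (by linarith) le_rfl
      rw [hp.tailProd_of_le hω A (by linarith [ht.2])] at this
      simpa [-zero_smul, exp_zero_smul] using this
  refine ⟨G, fun t ht => ⟨?_, hDG t ht⟩, ?_⟩
  · have hgr := le_gronwallBound_of_liminf_deriv_right_le (f := G)
      (f' := fun t => N * Real.exp (lam * (t - a)) * g t) (δ := U) (K := N * L)
      (ε := N * Real.exp (lam * ω) * ε) (a := a) (b := b)
      (fun t _ => (hG t).continuousAt.continuousWithinAt)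
      (fun t _ R hR => (hG t).hasDerivWithinAt.liminf_right_slope_le hR) hGa.le ?_ t ht
    · refine hgr.trans ?_
      have hNL : N * L ≠ 0 := by positivity
      rw [gronwallBound_of_K_ne_0 hNL]
      have hle : Real.exp (N * L * (t - a)) ≤ Real.exp (N * L * ω) := by
        have : t - a ≤ ω := by linarith [ht.2]
        gcongr
      have : N * Real.exp (lam * ω) * ε / (N * L) * (Real.exp (N * L * (t - a)) - 1) ≤
          N * Real.exp (lam * ω) * ε / (N * L) * Real.exp (N * L * ω) := by
        gcongr
        linarith
      refine (add_le_add_right this _).trans (le_of_eq ?_)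
      field_simp
    · intro t ht
      have ht' := Ico_subset_Icc_self ht
      have h1 : t - a ≤ ω := by linarith [ht.2]
      have h2 := hDG t ht'
      have h3 : Real.exp (lam * (t - a)) * ‖D t‖ ≤ G t := by
        calc _ ≤ Real.exp (lam * (t - a)) * (Real.exp (-lam * (t - a)) * G t) := by gcongr
          _ = G t := by
            rw [← mul_assoc, ← Real.exp_add]; simp
      have h4 : Real.exp (lam * (t - a)) * ε ≤ Real.exp (lam * ω) * ε := by gcongr
      rw [hgD t ht']
      calc N * Real.exp (lam * (t - a)) * (L * ‖D t‖ + ε)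
          = N * L * (Real.exp (lam * (t - a)) * ‖D t‖) + N * (Real.exp (lam * (t - a)) * ε) := by
            ring
        _ ≤ N * L * G t + N * (Real.exp (lam * ω) * ε) := by gcongr
        _ = _ := by ring
  · intro s' hs'
    rw [add_sub_cancel_right] at hs' ⊢
    have := main b (right_mem_Icc.2 hab.le) s' (by linarith) (by linarith)
    rw [hp.tailProd_of_lt hω A hs', ← hlen, sub_sub_sub_cancel_right, mul_assoc] at this
    have hcomm : Commute (1 + T.δ k • B) (NormedSpace.exp ((s' - T.s k) • B)) :=
      commute_one_add_smul_exp_smul B _ _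
    rw [hcomm.eq, ← mul_assoc] at this
    refine (le_of_eq ?_).trans (this.trans (le_of_eq ?_))
    · simp [hB]
    · rw [← hlen, mul_right_comm, ← Real.exp_add]
      congr 2
      ring

/-- The linear jump is already controlled by `V`; the extra term `δ_k y` costs at most `N δ_k ‖y‖`,
and `‖x‖ ≤ V` turns this into a multiple of `V` and `ε`. -/
theorem IsPeriodCount.decayBound_jump (hω : 0 < ω) (hp : T.IsPeriodCount ω p)
    {A : Matrix (Fin n) (Fin n) ℝ} {N lam L : ℝ} (hN : 0 < N)
    (hX : ∀ s r : ℝ, r ≤ s →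
      ‖Matrix.toEuclideanCLM (𝕜 := ℝ) (T.transition A s r)‖ ≤ N * Real.exp (-lam * (s - r)))
    {k : ℤ} {x y : EuclideanSpace ℝ (Fin n)} {ε V : ℝ} (hL : 0 ≤ L) (hx : ‖x‖ ≤ V)
    (hy : ‖y‖ ≤ L * ‖x‖ + ε)
    (h : T.DecayBound A lam (k + 1) (x + T.δ k • Matrix.toEuclideanCLM (𝕜 := ℝ) A x) V) :
    T.DecayBound A lam (k + 1) (x + T.δ k • (Matrix.toEuclideanCLM (𝕜 := ℝ) A x + y))
      ((1 + N * L * T.δ k) * V + N * T.δ k * ε) := by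
  have hδ := (T.δ_pos k).le
  have h2 := h.add (hp.decayBound hω hX (k + 1) (T.δ k • y))
  rw [add_assoc, ← smul_add] at h2
  refine h2.mono ?_
  rw [norm_smul, Real.norm_of_nonneg hδ]
  have : N * (T.δ k * ‖y‖) ≤ N * (T.δ k * (L * V + ε)) := by
    gcongr
    exact hy.trans (by gcongr)
  linarith

end IntervalTimeScale

/-! ### Uniform contraction from one interval to the next. -/

namespace IntervalTimeScale

variable {T : IntervalTimeScale} {ω : ℝ} {p n : ℕ}

/-- A family of bounds `Bd k x V` on states `x` at the left end of the `k`-th interval, comparable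
with the norm, that contracts by `κ` from one interval to the next along perturbations of the
linear equation that are at most `L‖D‖ + ε`. -/
structure ContractionEstimate (T : IntervalTimeScale) (A : Matrix (Fin n) (Fin n) ℝ) (L : ℝ) where
  C : ℝ
  κ : ℝ
  Bd : ℤ → EuclideanSpace ℝ (Fin n) → ℝ → Prop
  C_pos : 0 < C
  κ_pos : 0 < κ
  κ_lt_one : κ < 1
  mono : ∀ {k x V V'}, Bd k x V → V ≤ V' → Bd k x V'
  norm_le : ∀ {k x V}, Bd k x V → ‖x‖ ≤ C * V
  of_norm : ∀ k x, Bd k x (C * ‖x‖)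
  step : ∀ {k : ℤ} {D r : ℝ → EuclideanSpace ℝ (Fin n)} {ε V : ℝ}, 0 ≤ ε →
    ContinuousOn D (Icc (T.θ (2 * k - 1)) (T.θ (2 * k))) →
    (∀ t ∈ Ico (T.θ (2 * k - 1)) (T.θ (2 * k)),
      HasDerivWithinAt D (Matrix.toEuclideanCLM (𝕜 := ℝ) A (D t) + r t) (Ici t) t) →
    (∀ t ∈ Icc (T.θ (2 * k - 1)) (T.θ (2 * k)), ‖r t‖ ≤ L * ‖D t‖ + ε) →
    Bd k (D (T.θ (2 * k - 1))) V →
    (∀ t ∈ Icc (T.θ (2 * k - 1)) (T.θ (2 * k)), ‖D t‖ ≤ C * (V + ε)) ∧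
    Bd (k + 1) (D (T.θ (2 * k)) + T.δ k •
      (Matrix.toEuclideanCLM (𝕜 := ℝ) A (D (T.θ (2 * k))) + r (T.θ (2 * k)))) (κ * V + C * ε)

/-- The weight is the exponential of `μ` times the bounded deviation of `s_{k-1}` from mean growth,
so it trades the true length of an interval for the mean length `ψ(ω)/p`. -/
theorem IsPeriodCount.exists_weight (hω : 0 < ω) (hp : T.IsPeriodCount ω p) (μ : ℝ) :
    ∃ (W : ℝ) (w : ℤ → ℝ), 0 < W ∧ ∀ k, 0 < w k ∧ w k ≤ W ∧ 1 ≤ W * w k ∧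
      Real.exp (μ * (T.θ (2 * k) - T.θ (2 * k - 1))) * w k =
        Real.exp (μ * (T.ψ ω / p)) * w (k + 1) := by
  obtain ⟨B, hB⟩ := hp.exists_abs_s_sub_le hω
  have habs (k : ℤ) : |μ * (T.s (k - 1) - ((k - 1 : ℤ) : ℝ) * (T.ψ ω / p))| ≤ |μ| * B := by
    rw [abs_mul]
    exact mul_le_mul_of_nonneg_left (hB _) (abs_nonneg _)
  refine ⟨Real.exp (|μ| * B), fun k =>
    Real.exp (μ * (T.s (k - 1) - ((k - 1 : ℤ) : ℝ) * (T.ψ ω / p))), Real.exp_pos _,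
    fun k => ⟨Real.exp_pos _, Real.exp_le_exp.2 ((le_abs_self _).trans (habs k)), ?_, ?_⟩⟩
  · rw [← Real.exp_add]
    apply Real.one_le_exp
    linarith [habs k, neg_abs_le (μ * (T.s (k - 1) - ((k - 1 : ℤ) : ℝ) * (T.ψ ω / p)))]
  · rw [← Real.exp_add, ← Real.exp_add, ← T.s_sub_pred]
    congr 1
    rw [show k + 1 - 1 = k by ring]
    push_cast
    ring

theorem IsPeriodCount.exp_mul_lt_one (hω : 0 < ω) (hp : T.IsPeriodCount ω p) {a P lam : ℝ}
    (hP : 0 < P) (h : -lam + a + p / T.ψ ω * Real.log P < 0) :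
    Real.exp ((a - lam) * (T.ψ ω / p)) * P < 1 := by
  have hψ := hp.ψ_pos hω
  have hp0 : (0 : ℝ) < p := by exact_mod_cast hp.1
  have h1 : (-lam + a + p / T.ψ ω * Real.log P) * (T.ψ ω / p) < 0 :=
    mul_neg_of_neg_of_pos h (by positivity)
  have h2 : (-lam + a + p / T.ψ ω * Real.log P) * (T.ψ ω / p) =
      (a - lam) * (T.ψ ω / p) + Real.log P := by
    field_simp
    ring
  rw [h2] at h1
  have := Real.exp_lt_one_iff.2 h1
  rwa [Real.exp_add, Real.exp_log hP] at this

theorem IsPeriodCount.exists_interval_bound (hω : 0 < ω) (hp : T.IsPeriodCount ω p)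
    {A : Matrix (Fin n) (Fin n) ℝ} {N lam L : ℝ} (hN : 0 < N) (hlam : 0 < lam) (hL : 0 < L)
    (hX : ∀ s r : ℝ, r ≤ s →
      ‖Matrix.toEuclideanCLM (𝕜 := ℝ) (T.transition A s r)‖ ≤ N * Real.exp (-lam * (s - r))) :
    ∃ C : ℝ, 0 < C ∧ ∀ (k : ℤ) (D r : ℝ → EuclideanSpace ℝ (Fin n)) (ε U : ℝ), 0 ≤ ε → 0 ≤ U →
      ContinuousOn D (Icc (T.θ (2 * k - 1)) (T.θ (2 * k))) →
      (∀ t ∈ Ico (T.θ (2 * k - 1)) (T.θ (2 * k)),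
        HasDerivWithinAt D (Matrix.toEuclideanCLM (𝕜 := ℝ) A (D t) + r t) (Ici t) t) →
      (∀ t ∈ Icc (T.θ (2 * k - 1)) (T.θ (2 * k)), ‖r t‖ ≤ L * ‖D t‖ + ε) →
      T.DecayBound A lam k (D (T.θ (2 * k - 1))) U →
      (∀ t ∈ Icc (T.θ (2 * k - 1)) (T.θ (2 * k)), ‖D t‖ ≤ C * (U + ε)) ∧
      T.DecayBound A lam (k + 1) (D (T.θ (2 * k)) + T.δ k •
        (Matrix.toEuclideanCLM (𝕜 := ℝ) A (D (T.θ (2 * k))) + r (T.θ (2 * k))))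
        ((1 + N * L * T.δmax p) *
          (Real.exp ((N * L - lam) * (T.θ (2 * k) - T.θ (2 * k - 1))) * U) + C * ε) := by
  have hδm : 0 < T.δmax p := (T.δ_pos 0).trans_le (hp.δ_le 0)
  obtain ⟨C₁, hC₁⟩ : ∃ C₁, C₁ = Real.exp (lam * ω) / L * Real.exp (N * L * ω) := ⟨_, rfl⟩
  have hC₁0 : 0 < C₁ := by rw [hC₁]; positivity
  obtain ⟨P, hP⟩ : ∃ P, P = 1 + N * L * T.δmax p := ⟨_, rfl⟩
  have hP0 : 0 < P := by rw [hP]; positivity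
  obtain ⟨e, he⟩ : ∃ e, e = Real.exp (N * L * ω) := ⟨_, rfl⟩
  have he0 : 0 < e := by rw [he]; positivity
  -- The terms `e + C₁` serve the bound on the interval, and `P * C₁ + N * T.δmax p` the one after
  -- the gap.
  refine ⟨e + C₁ + P * C₁ + N * T.δmax p, by positivity,
    fun k D r ε U hε hU hD hD' hr h0 => ?_⟩
  obtain ⟨G, hG, hGb⟩ := hp.interval_estimate hω hN hlam hL hX hε hD hD' hr h0
  rw [← hC₁] at hG
  have hab := T.strictMono (show 2 * k - 1 < 2 * k by omega)
  have hexp {t : ℝ} (ht : T.θ (2 * k - 1) ≤ t) :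
      Real.exp (-lam * (t - T.θ (2 * k - 1))) ≤ 1 := by
    rw [Real.exp_le_one_iff]
    have := mul_nonneg hlam.le (sub_nonneg.2 ht)
    linarith
  constructor
  · intro t ht
    obtain ⟨h1, h2⟩ := hG t ht
    have htω : t - T.θ (2 * k - 1) ≤ ω := by linarith [ht.2, hp.length_le k]
    have hG0 : 0 ≤ G t := nonneg_of_mul_nonneg_right ((norm_nonneg _).trans h2) (Real.exp_pos _)
    have h3 : U * Real.exp (N * L * (t - T.θ (2 * k - 1))) ≤ U * e := by
      rw [he]
      gcongr
    have h4 : 0 ≤ (C₁ + P * C₁ + N * T.δmax p) * U := by positivity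
    have h5 : 0 ≤ (e + P * C₁ + N * T.δmax p) * ε := by positivity
    have h6 := h2.trans (mul_le_mul_of_nonneg_right (hexp ht.1) hG0)
    linarith
  · obtain ⟨h1, h2⟩ := hG _ (right_mem_Icc.2 hab.le)
    refine (hp.decayBound_jump hω hN hX hL.le h2 (hr _ (right_mem_Icc.2 hab.le)) hGb).mono ?_
    have hpos := (norm_nonneg _).trans h2
    have hδ : 1 + N * L * T.δ k ≤ P := by
      have := hp.δ_le k
      rw [hP]
      gcongr
    have hδ' : N * T.δ k * ε ≤ N * T.δmax p * ε := by
      have := hp.δ_le k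
      gcongr
    have h3 : Real.exp (-lam * (T.θ (2 * k) - T.θ (2 * k - 1))) * G (T.θ (2 * k)) ≤
        Real.exp ((N * L - lam) * (T.θ (2 * k) - T.θ (2 * k - 1))) * U + C₁ * ε := by
      refine (mul_le_mul_of_nonneg_left h1 (Real.exp_pos _).le).trans ?_
      have h4 := mul_le_mul_of_nonneg_right (hexp hab.le) (mul_nonneg hC₁0.le hε)
      rw [show (N * L - lam) * (T.θ (2 * k) - T.θ (2 * k - 1)) =
        -lam * (T.θ (2 * k) - T.θ (2 * k - 1)) + N * L * (T.θ (2 * k) - T.θ (2 * k - 1)) by ring,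
        Real.exp_add]
      linarith
    have h5 := mul_le_mul_of_nonneg_right hδ hpos
    have h6 := mul_le_mul_of_nonneg_left h3 hP0.le
    have h7 : 0 ≤ (e + C₁) * ε := by positivity
    rw [← hP]
    linarith

/-- `Bd k x V` is the decay bound with constant `V * w k`; the weights cancel the variation in
length, leaving the factor `κ` that (C6) places below `1`. -/
theorem IsPeriodCount.nonempty_contractionEstimate (hω : 0 < ω) (hp : T.IsPeriodCount ω p)
    {A : Matrix (Fin n) (Fin n) ℝ} {N lam L : ℝ} (hN : 0 < N) (hlam : 0 < lam) (hL : 0 < L)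
    (hX : ∀ s r : ℝ, r ≤ s →
      ‖Matrix.toEuclideanCLM (𝕜 := ℝ) (T.transition A s r)‖ ≤ N * Real.exp (-lam * (s - r)))
    (hdecay : -lam + N * L + p / T.ψ ω * Real.log (1 + N * L * T.δmax p) < 0) :
    Nonempty (T.ContractionEstimate A L) := by
  have hδm : 0 < T.δmax p := (T.δ_pos 0).trans_le (hp.δ_le 0)
  have hP0 : 0 < 1 + N * L * T.δmax p := by positivity
  obtain ⟨W, w, hW, hw⟩ := hp.exists_weight hω (N * L - lam)
  obtain ⟨C₀, hC₀, hstep⟩ := hp.exists_interval_bound hω hN hlam hL hX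
  have hV {k x V} (h : T.DecayBound A lam k x (V * w k)) : 0 ≤ V :=
    nonneg_of_mul_nonneg_left ((norm_nonneg x).trans (h.norm_le hω hp)) (hw k).1
  have hcoef {c C : ℝ} {k : ℤ} (hc : 0 ≤ c) (h : c * W ≤ C) : c ≤ C * w k := by
    have h1 := mul_le_mul_of_nonneg_left (hw k).2.2.1 hc
    have h2 := mul_le_mul_of_nonneg_right h (hw k).1.le
    linarith
  refine ⟨⟨W + N * W + C₀ * W + C₀,
    Real.exp ((N * L - lam) * (T.ψ ω / p)) * (1 + N * L * T.δmax p),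
    fun k x V => T.DecayBound A lam k x (V * w k), by positivity, by positivity,
    hp.exp_mul_lt_one hω hP0 hdecay,
    fun h hle => h.mono (mul_le_mul_of_nonneg_right hle (hw _).1.le), fun {k x V} h => ?_,
    fun k x => (hp.decayBound hω hX k x).mono ?_, fun {k D r ε V} hε hD hD' hr h0 => ?_⟩⟩
  · have h1 := mul_le_mul_of_nonneg_left (hw k).2.1 (hV h)
    have h2 : 0 ≤ (N * W + C₀ * W + C₀) * V := by have := hV h; positivity
    linarith [h.norm_le hω hp]
  · have h1 : N ≤ (W + N * W + C₀ * W + C₀) * w k := hcoef hN.le (by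
      have : 0 < W + C₀ * W + C₀ := by positivity
      linarith)
    rw [mul_right_comm]
    exact mul_le_mul_of_nonneg_right h1 (norm_nonneg _)
  · have hV0 := hV h0
    obtain ⟨h1, h2⟩ := hstep k D r ε (V * w k) hε (mul_nonneg hV0 (hw k).1.le) hD hD' hr h0
    refine ⟨fun t ht => (h1 t ht).trans ?_, h2.mono ?_⟩
    · have h3 := mul_le_mul_of_nonneg_left (mul_le_mul_of_nonneg_left (hw k).2.1 hV0) hC₀.le
      have h4 : 0 ≤ (W + N * W + C₀) * V + (W + N * W + C₀ * W) * ε := by positivity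
      linarith
    · have h3 : C₀ ≤ (W + N * W + C₀ * W + C₀) * w (k + 1) := hcoef hC₀.le (by
        have : 0 < W + N * W + C₀ := by positivity
        linarith)
      have h4 := mul_le_mul_of_nonneg_right h3 hε
      have h5 : (1 + N * L * T.δmax p) *
          (Real.exp ((N * L - lam) * (T.θ (2 * k) - T.θ (2 * k - 1))) * (V * w k)) =
          (1 + N * L * T.δmax p) * V *
            (Real.exp ((N * L - lam) * (T.ψ ω / p)) * w (k + 1)) := by
        rw [← (hw k).2.2.2]
        ring
      rw [h5]
      linarith

end IntervalTimeScale

/-! ### Solving the equation on a single interval. -/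

theorem exists_semilinear_solution {E : Type*} [NormedAddCommGroup E] [NormedSpace ℝ E]
    [CompleteSpace E] (B : E →L[ℝ] E) {h : ℝ → E → E} {a b L M : ℝ} (hab : a < b)
    (hcont : ∀ u, ∀ t ∈ Ico a b, ContinuousWithinAt (fun t => h t u) (Icc a b) t)
    (hlim : ∀ u, ∃ l, Tendsto (fun t => h t u) (𝓝[Ico a b] b) (𝓝 l))
    (hLip : ∀ t ∈ Icc a b, ∀ u v, ‖h t u - h t v‖ ≤ L * ‖u - v‖)
    (hM : ∀ t ∈ Icc a b, ∀ u, ‖h t u‖ ≤ M) (x₀ : E) :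
    ∃ y : ℝ → E, y a = x₀ ∧ ContinuousOn y (Icc a b) ∧
      ∀ t ∈ Ico a b, HasDerivWithinAt y (B (y t) + h t (y t)) (Icc a b) t := by
  choose l hl using hlim
  have : (𝓝[Ico a b] b).NeBot := by
    rw [nhdsWithin_Ico_eq_nhdsLT hab]; infer_instance
  have hmem : ∀ᶠ t in 𝓝[Ico a b] b, t ∈ Icc a b :=
    eventually_mem_nhdsWithin.mono fun t ht => Ico_subset_Icc_self ht
  -- Rd-continuity controls only the left limit at `b`. The field is given that limit as its value
  -- there, which leaves the equation on `[a, b)` unchanged.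
  let h' : ℝ → E → E := fun t u => Function.update (fun t => h t u) b (l u) t
  have h'_of_lt {t} (ht : t < b) (u) : h' t u = h t u := Function.update_of_ne ht.ne _ _
  have h'_b (u) : h' b u = l u := Function.update_self _ _ _
  have hLip' : ∀ t ∈ Icc a b, ∀ u v, ‖h' t u - h' t v‖ ≤ L * ‖u - v‖ := by
    intro t ht u v
    rcases ht.2.eq_or_lt with rfl | htb
    · rw [h'_b, h'_b]
      exact le_of_tendsto ((hl u).sub (hl v)).norm (hmem.mono fun t ht => hLip t ht u v)
    · rw [h'_of_lt htb, h'_of_lt htb]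
      exact hLip t ht u v
  have hM' : ∀ t ∈ Icc a b, ∀ u, ‖h' t u‖ ≤ M := by
    intro t ht u
    rcases ht.2.eq_or_lt with rfl | htb
    · rw [h'_b]
      exact le_of_tendsto (hl u).norm (hmem.mono fun t ht => hM t ht u)
    · rw [h'_of_lt htb]
      exact hM t ht u
  have hcont' (u) : ContinuousOn (fun t => h' t u) (Icc a b) := by
    intro t ht
    rcases ht.2.eq_or_lt with rfl | htb
    · refine continuousWithinAt_update_same.2 ?_
      rw [Icc_sdiff_right]
      exact hl u
    · exact (continuousWithinAt_update_of_ne htb.ne).2 (hcont u t ⟨ht.1, htb⟩)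
  have hL0 : 0 ≤ M := (norm_nonneg _).trans (hM a (left_mem_Icc.2 hab.le) 0)
  have hjoint : ContinuousOn (fun z : ℝ × E => h' z.1 z.2) (Icc a b ×ˢ univ) :=
    continuousOn_prod_of_continuousOn_lipschitzOnWith' (fun z : ℝ × E => h' z.1 z.2) L.toNNReal
      (fun t ht => LipschitzOnWith.of_dist_le_mul fun u _ v _ => by
        rw [dist_eq_norm, dist_eq_norm]
        exact (hLip' t ht u v).trans (by gcongr; exact Real.le_coe_toNNReal L))
      (fun u _ => hcont' u)
  have hS : Continuous fun t : ℝ => NormedSpace.exp ((t - a) • B) :=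
    (continuous_exp_smul B).comp (by fun_prop : Continuous fun t : ℝ => t - a)
  have hS' : Continuous fun t : ℝ => NormedSpace.exp ((-(t - a)) • B) :=
    (continuous_exp_smul B).comp (by fun_prop : Continuous fun t : ℝ => -(t - a))
  obtain ⟨R, hR⟩ := isCompact_Icc.exists_bound_of_continuousOn (s := Icc a b) hS.continuousOn
  obtain ⟨R', hR'⟩ := isCompact_Icc.exists_bound_of_continuousOn (s := Icc a b) hS'.continuousOn
  have hR0 : 0 ≤ R := (norm_nonneg _).trans (hR a (left_mem_Icc.2 hab.le))
  have hR0' : 0 ≤ R' := (norm_nonneg _).trans (hR' a (left_mem_Icc.2 hab.le))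
  -- The substitution `y = e^{(t-a)B} w` removes the unbounded linear term. The field for `w` is
  -- bounded by `R' * M`, so one Picard–Lindelöf ball of radius `R' * M * (b - a)` covers the whole
  -- interval.
  let v : ℝ → E → E := fun t w =>
    NormedSpace.exp ((-(t - a)) • B) (h' t (NormedSpace.exp ((t - a) • B) w))
  have hPL : IsPicardLindelof v (tmin := a) (tmax := b) ⟨a, left_mem_Icc.2 hab.le⟩ x₀
      (R' * M * (b - a)).toNNReal 0 (R' * M).toNNReal (R' * (L.toNNReal * R)).toNNReal := by
    refine ⟨fun t ht => LipschitzOnWith.of_dist_le_mul fun u _ w _ => ?_, fun u _ => ?_,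
      fun t ht u _ => ?_, ?_⟩
    · rw [dist_eq_norm, dist_eq_norm, Real.coe_toNNReal _ (by positivity)]
      simp only [v]
      rw [← map_sub]
      calc _ ≤ R' * ‖h' t (NormedSpace.exp ((t - a) • B) u) -
              h' t (NormedSpace.exp ((t - a) • B) w)‖ :=
            ContinuousLinearMap.le_of_opNorm_le _ (hR' t ht) _
        _ ≤ R' * (L.toNNReal * ‖NormedSpace.exp ((t - a) • B) (u - w)‖) := by
            rw [map_sub]
            gcongr
            exact (hLip' t ht _ _).trans (by gcongr; exact Real.le_coe_toNNReal L)
        _ ≤ R' * (L.toNNReal * (R * ‖u - w‖)) := by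
            gcongr
            exact ContinuousLinearMap.le_of_opNorm_le _ (hR t ht) _
        _ = _ := by ring
    · refine ContinuousOn.clm_apply hS'.continuousOn ?_
      refine hjoint.comp (f := fun t => (t, NormedSpace.exp ((t - a) • B) u)) ?_
        fun t ht => ⟨ht, mem_univ _⟩
      exact (continuous_id.prodMk (hS.clm_apply continuous_const)).continuousOn
    · rw [Real.coe_toNNReal _ (by positivity)]
      refine (ContinuousLinearMap.le_of_opNorm_le _ (hR' t ht) _).trans ?_
      gcongr
      exact hM' t ht _
    · have : 0 ≤ b - a := by linarith
      rw [Real.coe_toNNReal _ (by positivity), Real.coe_toNNReal _ (by positivity)]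
      simp [this]
  obtain ⟨w, hw0, hw⟩ := hPL.exists_eq_forall_mem_Icc_hasDerivWithinAt₀
  have hd (t : ℝ) : HasDerivAt (fun t : ℝ => NormedSpace.exp ((t - a) • B))
      (B * NormedSpace.exp ((t - a) • B)) t := by
    have h1 : HasDerivAt (fun t : ℝ => t - a) 1 t := (hasDerivAt_id t).sub_const a
    have h2 := (hasDerivAt_exp_smul_const' B (t - a)).scomp t h1
    rw [one_smul] at h2
    exact h2
  have hinv (t : ℝ) (x : E) :
      NormedSpace.exp (t • B) (NormedSpace.exp ((-t) • B) x) = x := by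
    have : NormedSpace.exp (t • B) * NormedSpace.exp ((-t) • B) = 1 := by
      let _ : NormedAlgebra ℚ (E →L[ℝ] E) := .restrictScalars ℚ ℝ _
      rw [← NormedSpace.exp_add_of_commute (((Commute.refl B).smul_left t).smul_right (-t)),
        ← add_smul, add_neg_cancel, exp_zero_smul]
    exact congrArg (· x) this
  have hy (t) (ht : t ∈ Icc a b) :
      HasDerivWithinAt (fun t => NormedSpace.exp ((t - a) • B) (w t))
        (B (NormedSpace.exp ((t - a) • B) (w t)) + h' t (NormedSpace.exp ((t - a) • B) (w t)))
        (Icc a b) t := by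
    have := (hd t).hasDerivWithinAt.clm_apply (hw t ht)
    simpa only [v, hinv, mul_apply_eq_comp] using this
  refine ⟨fun t => NormedSpace.exp ((t - a) • B) (w t), ?_,
    fun t ht => (hy t ht).continuousWithinAt, fun t ht => ?_⟩
  · simp only [sub_self, exp_zero_smul]
    exact hw0
  · have := hy t (Ico_subset_Icc_self ht)
    rwa [h'_of_lt ht.2] at this

/-! ### Solutions on the time scale as chains of pieces. -/

namespace IntervalTimeScale

variable {T : IntervalTimeScale} {n : ℕ}

theorem θ_left_lt (T : IntervalTimeScale) (k : ℤ) : T.θ (2 * k - 1) < T.θ (2 * k) :=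
  T.strictMono (by omega)

theorem Icc_subset_carrier (T : IntervalTimeScale) (k : ℤ) :
    Icc (T.θ (2 * k - 1)) (T.θ (2 * k)) ⊆ T.carrier :=
  subset_iUnion (fun k : ℤ => Icc (T.θ (2 * k - 1)) (T.θ (2 * k))) k

theorem le_of_mem_carrier_of_lt {k : ℤ} {x : ℝ} (hx : x ∈ T.carrier) (h : T.θ (2 * k) < x) :
    T.θ (2 * k + 1) ≤ x := by
  obtain ⟨j, hj⟩ := mem_iUnion.1 hx
  have := T.strictMono.lt_iff_lt.1 (h.trans_le hj.2)
  exact (T.strictMono.monotone (by omega)).trans hj.1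

theorem eq_of_mem_Icc {j k : ℤ} {x : ℝ} (hj : x ∈ Icc (T.θ (2 * j - 1)) (T.θ (2 * j)))
    (hk : x ∈ Icc (T.θ (2 * k - 1)) (T.θ (2 * k))) : j = k := by
  have h1 := T.strictMono.le_iff_le.1 (hj.1.trans hk.2)
  have h2 := T.strictMono.le_iff_le.1 (hk.1.trans hj.2)
  omega

/-- The gaps on both sides isolate the `k`-th interval from the others. -/
theorem nhdsWithin_carrier {k : ℤ} {t : ℝ} (ht : t ∈ Icc (T.θ (2 * k - 1)) (T.θ (2 * k))) :
    𝓝[T.carrier] t = 𝓝[Icc (T.θ (2 * k - 1)) (T.θ (2 * k))] t := by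
  refine nhdsWithin_eq_nhdsWithin (s := Ioo (T.θ (2 * k - 2)) (T.θ (2 * k + 1)))
    ⟨(T.strictMono (by omega)).trans_le ht.1, ht.2.trans_lt (T.strictMono (by omega))⟩ isOpen_Ioo ?_
  ext x
  refine ⟨fun ⟨hx, hx'⟩ => ⟨⟨?_, ?_⟩, hx'⟩, fun ⟨hx, hx'⟩ => ⟨T.Icc_subset_carrier k hx, hx'⟩⟩
  · have := le_of_mem_carrier_of_lt (k := k - 1) hx (by
      rw [show 2 * (k - 1) = 2 * k - 2 by ring]; exact hx'.1)
    rwa [show 2 * (k - 1) + 1 = 2 * k - 1 by ring] at this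
  · by_contra! h
    exact absurd (le_of_mem_carrier_of_lt hx h) (not_le.2 hx'.2)

theorem hasDerivWithinAt_carrier {E : Type*} [NormedAddCommGroup E] [NormedSpace ℝ E] {y : ℝ → E}
    {v : E} {k : ℤ} {t : ℝ} (ht : t ∈ Icc (T.θ (2 * k - 1)) (T.θ (2 * k))) :
    HasDerivWithinAt y v T.carrier t ↔
      HasDerivWithinAt y v (Icc (T.θ (2 * k - 1)) (T.θ (2 * k))) t := by
  rw [HasDerivWithinAt, nhdsWithin_carrier ht, HasDerivWithinAt]

theorem fwdJump_of_mem_Ico {k : ℤ} {t : ℝ} (ht : t ∈ Ico (T.θ (2 * k - 1)) (T.θ (2 * k))) :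
    fwdJump T.carrier t = t := by
  refine IsGLB.csInf_eq ⟨fun x hx => hx.2.le, fun x hx => ?_⟩
    ⟨T.θ (2 * k), T.Icc_subset_carrier k (right_mem_Icc.2 (T.θ_left_lt k).le), ht.2⟩
  refine le_of_forall_gt_imp_ge_of_dense fun y hy => ?_
  have h : t < min y (T.θ (2 * k)) := lt_min hy ht.2
  exact (hx ⟨T.Icc_subset_carrier k ⟨ht.1.trans h.le, min_le_right _ _⟩, h⟩).trans (min_le_left _ _)

theorem bwdJump_of_mem_Ioc {k : ℤ} {t : ℝ} (ht : t ∈ Ioc (T.θ (2 * k - 1)) (T.θ (2 * k))) :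
    bwdJump T.carrier t = t := by
  refine IsLUB.csSup_eq ⟨fun x hx => hx.2.le, fun x hx => ?_⟩
    ⟨T.θ (2 * k - 1), T.Icc_subset_carrier k (left_mem_Icc.2 (T.θ_left_lt k).le), ht.1⟩
  refine le_of_forall_lt_imp_le_of_dense fun y hy => ?_
  have h : max y (T.θ (2 * k - 1)) < t := max_lt hy ht.1
  exact (le_max_left _ _).trans
    (hx ⟨T.Icc_subset_carrier k ⟨le_max_right _ _, h.le.trans ht.2⟩, h⟩)

theorem fwdJump_right (T : IntervalTimeScale) (k : ℤ) :
    fwdJump T.carrier (T.θ (2 * k)) = T.θ (2 * k + 1) := by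
  refine IsLeast.csInf_eq ⟨⟨?_, T.strictMono (by omega)⟩, fun x hx =>
    le_of_mem_carrier_of_lt hx.1 hx.2⟩
  refine T.Icc_subset_carrier (k + 1) ⟨?_, T.strictMono.monotone (by omega)⟩
  rw [show 2 * (k + 1) - 1 = 2 * k + 1 by ring]

/-- A solution on the `k`-th interval, together with the value `x'` it takes at the beginning of
the next one. -/
structure IsPiece (T : IntervalTimeScale) (A : Matrix (Fin n) (Fin n) ℝ)
    (f : ℝ → EuclideanSpace ℝ (Fin n) → EuclideanSpace ℝ (Fin n)) (k : ℤ)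
    (z : EuclideanSpace ℝ (Fin n)) (y : ℝ → EuclideanSpace ℝ (Fin n))
    (x' : EuclideanSpace ℝ (Fin n)) : Prop where
  continuousOn : ContinuousOn y (Icc (T.θ (2 * k - 1)) (T.θ (2 * k)))
  deriv : ∀ t ∈ Ico (T.θ (2 * k - 1)) (T.θ (2 * k)),
    HasDerivWithinAt y (Matrix.toEuclideanCLM (𝕜 := ℝ) A (y t) + f t (y t) + z)
      (Icc (T.θ (2 * k - 1)) (T.θ (2 * k))) t
  jump : x' = y (T.θ (2 * k)) + T.δ k • (Matrix.toEuclideanCLM (𝕜 := ℝ) A (y (T.θ (2 * k))) +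
    (f (T.θ (2 * k)) (y (T.θ (2 * k))) + z))

variable {A : Matrix (Fin n) (Fin n) ℝ}
  {f : ℝ → EuclideanSpace ℝ (Fin n) → EuclideanSpace ℝ (Fin n)}

/-- All points of an interval but its right end are right-dense, where the equation is an ordinary
one. At the right-scattered end `θ_{2k}` it is a difference quotient across the gap, and solving for
the next value gives the jump. -/
theorem isSolution_iff {ζ : ℤ → EuclideanSpace ℝ (Fin n)} {y : ℝ → EuclideanSpace ℝ (Fin n)} :
    T.IsSolution A f ζ y ↔ ∀ k, T.IsPiece A f k (ζ k) y (y (T.θ (2 * k + 1))) := by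
  have hδ (k) : T.δ k ≠ 0 := (T.δ_pos k).ne'
  constructor
  · intro h k
    refine ⟨fun t ht => ?_, fun t ht => ?_, ?_⟩
    · have := (h k t ht).1
      rwa [ContinuousWithinAt, nhdsWithin_carrier ht] at this
    · have ht' := Ico_subset_Icc_self ht
      have := (h k t ht').2.2 (fwdJump_of_mem_Ico ht)
      exact (hasDerivWithinAt_carrier ht').1 this
    · have h1 := (h k _ (right_mem_Icc.2 (T.θ_left_lt k).le)).2.1
      rw [fwdJump_right] at h1
      have h2 := h1 (T.strictMono (by omega))
      rw [← add_assoc, h2, ← δ, smul_inv_smul₀ (hδ k), add_sub_cancel]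
  · intro h k t ht
    refine ⟨?_, fun hlt => ?_, fun heq => ?_⟩
    · rw [ContinuousWithinAt, nhdsWithin_carrier ht]
      exact (h k).continuousOn t ht
    · have htb : t = T.θ (2 * k) := by
        by_contra hne
        exact hlt.ne' (fwdJump_of_mem_Ico ⟨ht.1, lt_of_le_of_ne ht.2 hne⟩)
      subst htb
      rw [fwdJump_right, (h k).jump, ← δ, add_sub_cancel_left, inv_smul_smul₀ (hδ k), add_assoc]
    · have htb : t < T.θ (2 * k) := by
        refine lt_of_le_of_ne ht.2 ?_
        rintro rfl
        rw [fwdJump_right] at heq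
        exact (T.strictMono (show 2 * k < 2 * k + 1 by omega)).ne' heq
      exact (hasDerivWithinAt_carrier ht).2 ((h k).deriv t ⟨ht.1, htb⟩)

end IntervalTimeScale

namespace IntervalTimeScale

variable {T : IntervalTimeScale} {n : ℕ} {A : Matrix (Fin n) (Fin n) ℝ}
  {f : ℝ → EuclideanSpace ℝ (Fin n) → EuclideanSpace ℝ (Fin n)} {L M : ℝ}

theorem exists_isPiece (hf : RdContinuous T.carrier f) (hM : ∀ t ∈ T.carrier, ∀ y, ‖f t y‖ ≤ M)
    (hL : ∀ t ∈ T.carrier, ∀ y₁ y₂, ‖f t y₁ - f t y₂‖ ≤ L * ‖y₁ - y₂‖)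
    (k : ℤ) (z x : EuclideanSpace ℝ (Fin n)) :
    ∃ y x', y (T.θ (2 * k - 1)) = x ∧ T.IsPiece A f k z y x' := by
  have hsub := T.Icc_subset_carrier k
  have hab := T.θ_left_lt k
  have hcont (u : EuclideanSpace ℝ (Fin n)) : ∀ t ∈ Ico (T.θ (2 * k - 1)) (T.θ (2 * k)),
      ContinuousWithinAt (fun t => f t u + z) (Icc (T.θ (2 * k - 1)) (T.θ (2 * k))) t := by
    intro t ht
    have h1 := hf.1 t (hsub (Ico_subset_Icc_self ht)) (fwdJump_of_mem_Ico ht) u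
    have h2 : ContinuousWithinAt (fun t : ℝ => (t, u)) (Icc (T.θ (2 * k - 1)) (T.θ (2 * k))) t := by
      fun_prop
    exact (h1.comp (f := fun t : ℝ => (t, u)) h2
      fun s hs => ⟨hsub hs, mem_univ _⟩).add continuousWithinAt_const
  have hlim (u : EuclideanSpace ℝ (Fin n)) : ∃ l, Tendsto (fun t => f t u + z)
      (𝓝[Ico (T.θ (2 * k - 1)) (T.θ (2 * k))] T.θ (2 * k)) (𝓝 l) := by
    obtain ⟨l, hl⟩ := (hf.2 _ (hsub (right_mem_Icc.2 hab.le))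
      (bwdJump_of_mem_Ioc (right_mem_Ioc.2 hab)) u).1
    refine ⟨l + z, Tendsto.add_const z ?_⟩
    refine (hl.mono_left (prod_mono_left _ (nhdsWithin_mono _ ?_))).comp
      (tendsto_id.prodMk tendsto_const_nhds)
    exact fun t ht => ⟨hsub (Ico_subset_Icc_self ht), ht.2⟩
  obtain ⟨y, h0, hc, hd⟩ := exists_semilinear_solution (Matrix.toEuclideanCLM (𝕜 := ℝ) A) hab
    hcont hlim (L := L) (M := M + ‖z‖)
    (fun t ht u v => by simpa using hL t (hsub ht) u v)
    (fun t ht u => norm_add_le_of_le (hM t (hsub ht) u) le_rfl) x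
  exact ⟨y, _, h0, hc, fun t ht => by simpa only [add_assoc] using hd t ht, rfl⟩

theorem IsPiece.congr {k : ℤ} {z x' : EuclideanSpace ℝ (Fin n)}
    {y y' : ℝ → EuclideanSpace ℝ (Fin n)} (h : T.IsPiece A f k z y x')
    (he : EqOn y' y (Icc (T.θ (2 * k - 1)) (T.θ (2 * k)))) : T.IsPiece A f k z y' x' where
  continuousOn := h.continuousOn.congr he
  deriv t ht := by
    have ht' := Ico_subset_Icc_self ht
    rw [he ht']
    exact (h.deriv t ht).congr he (he ht')
  jump := by
    rw [he (right_mem_Icc.2 (T.θ_left_lt k).le)]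
    exact h.jump

theorem IsPiece.deriv_Ici {k : ℤ} {z x' : EuclideanSpace ℝ (Fin n)}
    {y : ℝ → EuclideanSpace ℝ (Fin n)} (h : T.IsPiece A f k z y x') {t : ℝ}
    (ht : t ∈ Ico (T.θ (2 * k - 1)) (T.θ (2 * k))) :
    HasDerivWithinAt y (Matrix.toEuclideanCLM (𝕜 := ℝ) A (y t) + f t (y t) + z) (Ici t) t :=
  (h.deriv t ht).mono_of_mem_nhdsWithin (Icc_mem_nhdsGE_of_mem ht)

/-! ### Bounded solutions: existence, uniqueness and dependence on the forcing. -/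

namespace ContractionEstimate

/-- Here all of `f + z` counts as forcing of size `M + R`, so no smallness of the Lipschitz part is
needed. -/
theorem piece_bound (S : T.ContractionEstimate A L) (hL0 : 0 ≤ L) (hM : ∀ t ∈ T.carrier, ∀ y, ‖f t y‖ ≤ M) (hM0 : 0 ≤ M) {k : ℤ}
    {z x' : EuclideanSpace ℝ (Fin n)} {y : ℝ → EuclideanSpace ℝ (Fin n)} {R V : ℝ}
    (h : T.IsPiece A f k z y x') (hz : ‖z‖ ≤ R) (hV : S.Bd k (y (T.θ (2 * k - 1))) V) :
    (∀ t ∈ Icc (T.θ (2 * k - 1)) (T.θ (2 * k)), ‖y t‖ ≤ S.C * (V + (M + R))) ∧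
      S.Bd (k + 1) x' (S.κ * V + S.C * (M + R)) := by
  rw [h.jump]
  refine S.step (r := fun t => f t (y t) + z) (add_nonneg hM0 ((norm_nonneg z).trans hz))
    h.continuousOn (fun t ht => ?_) (fun t ht => ?_) hV
  · rw [← add_assoc]
    exact h.deriv_Ici ht
  · have := norm_add_le_of_le (hM t (T.Icc_subset_carrier k ht) (y t)) hz
    have := mul_nonneg hL0 (norm_nonneg (y t))
    linarith

theorem piece_sub_bound (S : T.ContractionEstimate A L)
    (hL : ∀ t ∈ T.carrier, ∀ y₁ y₂, ‖f t y₁ - f t y₂‖ ≤ L * ‖y₁ - y₂‖) {k : ℤ}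
    {z₁ z₂ x₁ x₂ : EuclideanSpace ℝ (Fin n)} {y₁ y₂ : ℝ → EuclideanSpace ℝ (Fin n)} {ε V : ℝ}
    (h₁ : T.IsPiece A f k z₁ y₁ x₁) (h₂ : T.IsPiece A f k z₂ y₂ x₂) (hz : ‖z₁ - z₂‖ ≤ ε)
    (hV : S.Bd k (y₁ (T.θ (2 * k - 1)) - y₂ (T.θ (2 * k - 1))) V) :
    (∀ t ∈ Icc (T.θ (2 * k - 1)) (T.θ (2 * k)), ‖y₁ t - y₂ t‖ ≤ S.C * (V + ε)) ∧
      S.Bd (k + 1) (x₁ - x₂) (S.κ * V + S.C * ε) := by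
  have key := S.step (D := fun t => y₁ t - y₂ t) (k := k)
    (r := fun t => (f t (y₁ t) - f t (y₂ t)) + (z₁ - z₂)) ((norm_nonneg _).trans hz)
    (h₁.continuousOn.sub h₂.continuousOn) (fun t ht => ?_) (fun t ht => ?_) hV
  · refine ⟨key.1, ?_⟩
    convert key.2 using 1
    rw [h₁.jump, h₂.jump]
    simp only [map_sub, smul_add, smul_sub]
    abel
  · refine ((h₁.deriv_Ici ht).sub (h₂.deriv_Ici ht)).congr_deriv ?_
    rw [map_sub]
    abel
  · exact norm_add_le_of_le (hL t (T.Icc_subset_carrier k ht) _ _) hz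

theorem bd_iterate (S : T.ContractionEstimate A L) {c : ℝ} (hc : 0 ≤ c) {d : ℤ → EuclideanSpace ℝ (Fin n)} {k : ℤ} {V : ℝ} {m : ℕ}
    (h : ∀ j : ℕ, j < m → ∀ V, S.Bd (k + j) (d (k + j)) V →
      S.Bd (k + j + 1) (d (k + j + 1)) (S.κ * V + c)) (h0 : S.Bd k (d k) V) :
    S.Bd (k + m) (d (k + m)) (S.κ ^ m * V + c / (1 - S.κ)) := by
  have hκ : 0 < 1 - S.κ := sub_pos.2 S.κ_lt_one
  induction m with
  | zero =>
    have : 0 ≤ c / (1 - S.κ) := by positivity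
    simpa using S.mono h0 (le_add_of_nonneg_right this)
  | succ m ih =>
    have := h m (by omega) _ (ih fun j hj => h j (by omega))
    push_cast
    rw [← add_assoc]
    refine S.mono this (le_of_eq ?_)
    field_simp
    ring

theorem bd_zero (S : T.ContractionEstimate A L) (k : ℤ) : S.Bd k 0 0 := by simpa using S.of_norm k 0

/-- The state at time `k` of the orbit of `P` started from `0` at time `k - m`. -/
def _root_.pullbackOrbit {E : Type*} [Zero E] (P : ℤ → E → E) : ℕ → ℤ → E
  | 0, _ => 0
  | m + 1, k => P (k - 1) (pullbackOrbit P m (k - 1))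

/-- The bound `V = c / (1 - κ)` is invariant, so all pullback orbits from `0` obey it. Starting one
step earlier changes the state at `k` by at most a multiple of `κ ^ m`; hence the pullbacks
converge. -/
theorem exists_bounded_orbit (S : T.ContractionEstimate A L)
    {P : ℤ → EuclideanSpace ℝ (Fin n) → EuclideanSpace ℝ (Fin n)} {c : ℝ} (hc : 0 ≤ c)
    (hP : ∀ k x V, S.Bd k x V → S.Bd (k + 1) (P k x) (S.κ * V + c))
    (hP' : ∀ k x x' V, S.Bd k (x - x') V → S.Bd (k + 1) (P k x - P k x') (S.κ * V)) :
    ∃ x : ℤ → EuclideanSpace ℝ (Fin n), (∀ k, x (k + 1) = P k (x k)) ∧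
      ∃ K, ∀ k, ‖x k‖ ≤ K := by
  have hκ : 0 < 1 - S.κ := sub_pos.2 S.κ_lt_one
  have hC := S.C_pos
  have hκ0 := S.κ_pos
  set V := c / (1 - S.κ) with hV
  have hV0 : 0 ≤ V := by positivity
  have hVc : S.κ * V + c = V := by rw [hV]; field_simp; ring
  have hbd (m : ℕ) : ∀ k, S.Bd k (pullbackOrbit P m k) V := by
    induction m with
    | zero => exact fun k => S.mono (S.bd_zero k) hV0
    | succ m ih =>
      intro k
      have := hP _ _ _ (ih (k - 1))
      rwa [hVc, sub_add_cancel] at this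
  have hdiff (m : ℕ) : ∀ k,
      S.Bd k (pullbackOrbit P (m + 1) k - pullbackOrbit P m k) (V * S.κ ^ m) := by
    induction m with
    | zero =>
      intro k
      rw [pow_zero, mul_one, show pullbackOrbit P 0 k = 0 from rfl, sub_zero]
      exact hbd 1 k
    | succ m ih =>
      intro k
      have := hP' _ _ _ _ (ih (k - 1))
      rw [sub_add_cancel] at this
      exact S.mono this (by rw [pow_succ]; linarith)
  have hcauchy (k : ℤ) : CauchySeq fun m => pullbackOrbit P m k := by
    refine cauchySeq_of_le_geometric S.κ (S.C * V) S.κ_lt_one fun m => ?_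
    rw [dist_comm, dist_eq_norm, mul_assoc]
    exact S.norm_le (hdiff m k)
  choose x hx using fun k => cauchySeq_tendsto_of_complete (hcauchy k)
  refine ⟨x, fun k => ?_, S.C * V, fun k =>
    le_of_tendsto (hx k).norm (Eventually.of_forall fun m => S.norm_le (hbd m k))⟩
  refine tendsto_nhds_unique ((hx (k + 1)).comp (tendsto_add_atTop_nat 1)) ?_
  have h1 : ((fun m => pullbackOrbit P m (k + 1)) ∘ fun m => m + 1) =
      fun m => P k (pullbackOrbit P m k) := by
    funext m
    simp [pullbackOrbit]
  rw [h1, tendsto_iff_norm_sub_tendsto_zero]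
  -- The contraction, read in norms, makes `P k` Lipschitz, so the limit passes through it.
  have h2 : Tendsto (fun m => S.C * (S.κ * (S.C * ‖pullbackOrbit P m k - x k‖))) atTop (𝓝 0) := by
    have := tendsto_iff_norm_sub_tendsto_zero.1 (hx k)
    simpa using ((this.const_mul S.C).const_mul S.κ).const_mul S.C
  exact squeeze_zero (fun _ => norm_nonneg _)
    (fun m => S.norm_le (hP' k _ _ _ (S.of_norm k _))) h2

theorem exists_isBoundedSolution (S : T.ContractionEstimate A L) (hL0 : 0 ≤ L) (hf : RdContinuous T.carrier f)
    (hM : ∀ t ∈ T.carrier, ∀ y, ‖f t y‖ ≤ M) (hM0 : 0 ≤ M)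
    (hL : ∀ t ∈ T.carrier, ∀ y₁ y₂, ‖f t y₁ - f t y₂‖ ≤ L * ‖y₁ - y₂‖)
    {ζ : ℤ → EuclideanSpace ℝ (Fin n)} {R : ℝ} (hR : ∀ k, ‖ζ k‖ ≤ R) :
    ∃ y, T.IsBoundedSolution A f ζ y := by
  have hR0 : 0 ≤ R := (norm_nonneg _).trans (hR 0)
  have hC := S.C_pos
  choose Y P hY hYP using fun k x => exists_isPiece (A := A) hf hM hL k (ζ k) x
  obtain ⟨x, hx, K, hK⟩ := S.exists_bounded_orbit (P := P) (c := S.C * (M + R)) (by positivity)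
    (fun k x V h => (S.piece_bound hL0 hM hM0 (hYP k x) (hR k) (by rwa [hY])).2)
    (fun k x x' V h => by
      have := (S.piece_sub_bound hL (hYP k x) (hYP k x') (ε := 0) (by simp) (by rwa [hY, hY])).2
      simpa using this)
  classical
  -- The intervals are disjoint, so the chosen index is the only one.
  let y : ℝ → EuclideanSpace ℝ (Fin n) := fun t =>
    if h : ∃ k : ℤ, t ∈ Icc (T.θ (2 * k - 1)) (T.θ (2 * k)) then Y h.choose (x h.choose) t else 0
  have hy (k : ℤ) : EqOn y (Y k (x k)) (Icc (T.θ (2 * k - 1)) (T.θ (2 * k))) := by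
    intro t ht
    have h : ∃ k : ℤ, t ∈ Icc (T.θ (2 * k - 1)) (T.θ (2 * k)) := ⟨k, ht⟩
    simp only [y, dif_pos h, eq_of_mem_Icc h.choose_spec ht]
  refine ⟨y, isSolution_iff.2 fun k => ?_, S.C * (S.C * K + (M + R)), fun t ht => ?_⟩
  · have h1 : y (T.θ (2 * k + 1)) = P k (x k) := by
      have h2 := hy (k + 1) (left_mem_Icc.2 (T.θ_left_lt (k + 1)).le)
      rw [hY, hx] at h2
      rwa [show 2 * (k + 1) - 1 = 2 * k + 1 by ring] at h2
    rw [h1]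
    exact (hYP k (x k)).congr (hy k)
  · obtain ⟨k, hk⟩ := mem_iUnion.1 ht
    rw [hy k hk]
    refine (S.piece_bound hL0 hM hM0 (hYP k (x k)) (hR k) (V := S.C * K) ?_).1 t hk
    rw [hY]
    exact S.mono (S.of_norm k _) (mul_le_mul_of_nonneg_left (hK k) hC.le)

theorem norm_sub_le (S : T.ContractionEstimate A L) (hL : ∀ t ∈ T.carrier, ∀ y₁ y₂, ‖f t y₁ - f t y₂‖ ≤ L * ‖y₁ - y₂‖)
    {ζ ζ' : ℤ → EuclideanSpace ℝ (Fin n)} {y z : ℝ → EuclideanSpace ℝ (Fin n)} {K η : ℝ}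
    (hy : T.IsSolution A f ζ y) (hz : T.IsSolution A f ζ' z)
    (hK : ∀ t ∈ T.carrier, ‖y t - z t‖ ≤ K) {k : ℤ} {m : ℕ}
    (hη : ∀ j : ℕ, j ≤ m → ‖ζ (k + j) - ζ' (k + j)‖ ≤ η) {t : ℝ}
    (ht : t ∈ Icc (T.θ (2 * (k + m) - 1)) (T.θ (2 * (k + m)))) :
    ‖y t - z t‖ ≤ S.C * (S.κ ^ m * (S.C * K) + S.C * η / (1 - S.κ) + η) := by
  rw [isSolution_iff] at hy hz
  have hη0 : 0 ≤ η := (norm_nonneg _).trans (hη 0 (by omega))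
  have h0 : S.Bd k (y (T.θ (2 * k - 1)) - z (T.θ (2 * k - 1))) (S.C * K) :=
    S.mono (S.of_norm k _) (mul_le_mul_of_nonneg_left
      (hK _ (T.Icc_subset_carrier k (left_mem_Icc.2 (T.θ_left_lt k).le))) S.C_pos.le)
  have h1 := S.bd_iterate (c := S.C * η) (m := m)
    (d := fun k => y (T.θ (2 * k - 1)) - z (T.θ (2 * k - 1))) (mul_nonneg S.C_pos.le hη0)
    (fun j hj V hV => by
      have := (S.piece_sub_bound hL (hy _) (hz _) (hη j hj.le) hV).2
      rwa [show 2 * (k + (j : ℤ)) + 1 = 2 * (k + j + 1) - 1 by ring] at this) h0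
  exact (S.piece_sub_bound hL (hy _) (hz _) (hη m le_rfl) h1).1 t ht

/-- With equal forcings `η = 0`; starting `m` intervals earlier leaves only the `κ ^ m` term, which
vanishes as `m → ∞`. -/
theorem eqOn_of_isBoundedSolution (S : T.ContractionEstimate A L)
    (hL : ∀ t ∈ T.carrier, ∀ y₁ y₂, ‖f t y₁ - f t y₂‖ ≤ L * ‖y₁ - y₂‖)
    {ζ : ℤ → EuclideanSpace ℝ (Fin n)} {y z : ℝ → EuclideanSpace ℝ (Fin n)}
    (hy : T.IsBoundedSolution A f ζ y) (hz : T.IsBoundedSolution A f ζ z) :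
    EqOn z y T.carrier := by
  obtain ⟨hy, K, hK⟩ := hy
  obtain ⟨hz, K', hK'⟩ := hz
  intro t ht
  obtain ⟨k, hk⟩ := mem_iUnion.1 ht
  have h (m : ℕ) : ‖z t - y t‖ ≤ S.C * (S.κ ^ m * (S.C * (K' + K))) := by
    have := S.norm_sub_le hL hz hy (K := K' + K) (η := 0) (k := k - m) (m := m)
      (fun t ht => norm_sub_le_of_le (hK' t ht) (hK t ht)) (by simp) (t := t)
      (by rwa [sub_add_cancel])
    simpa using this
  have hlim : Tendsto (fun m : ℕ => S.C * (S.κ ^ m * (S.C * (K' + K)))) atTop (𝓝 0) := by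
    simpa using ((tendsto_pow_atTop_nhds_zero_of_lt_one S.κ_pos.le S.κ_lt_one).mul_const
      (S.C * (K' + K))).const_mul S.C
  have := ge_of_tendsto' hlim h
  exact sub_eq_zero.1 (norm_le_zero_iff.1 this)

theorem exists_isUniqueBoundedSolution (S : T.ContractionEstimate A L) (hL0 : 0 ≤ L) (hf : RdContinuous T.carrier f)
    (hM : ∀ t ∈ T.carrier, ∀ y, ‖f t y‖ ≤ M) (hM0 : 0 ≤ M)
    (hL : ∀ t ∈ T.carrier, ∀ y₁ y₂, ‖f t y₁ - f t y₂‖ ≤ L * ‖y₁ - y₂‖)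
    {ζ : ℤ → EuclideanSpace ℝ (Fin n)} {R : ℝ} (hR : ∀ k, ‖ζ k‖ ≤ R) :
    ∃ y, T.IsUniqueBoundedSolution A f ζ y := by
  obtain ⟨y, hy⟩ := S.exists_isBoundedSolution hL0 hf hM hM0 hL hR
  exact ⟨y, hy, fun z hz => S.eqOn_of_isBoundedSolution hL hy hz⟩

end ContractionEstimate

end IntervalTimeScale

/-! ### Proximal sequences stay close over long stretches. -/

section Sequences

variable {V : Type*} [NormedAddCommGroup V] {F : V → V} {Λ : Set V} {ζ ζ' : ℤ → V}

/-- Induction on `m`: `F` is uniformly continuous on the compact `Λ`, so closeness at `k` forces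
closeness at `k + 1`, uniformly in `k`. -/
theorem exists_forall_le_norm_sub_lt (hΛ : IsCompact Λ) (hF : ContinuousOn F Λ)
    (hζ : ζ ∈ generatedSeqs F Λ) (hζ' : ζ' ∈ generatedSeqs F Λ) (m : ℕ) {η : ℝ} (hη : 0 < η) :
    ∃ η₀ > 0, ∀ k : ℤ, ‖ζ k - ζ' k‖ < η₀ → ∀ j : ℕ, j ≤ m → ‖ζ (k + j) - ζ' (k + j)‖ < η := by
  have hunif := Metric.uniformContinuousOn_iff.1 (hΛ.uniformContinuousOn_of_continuous hF)
  induction m with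
  | zero =>
    refine ⟨η, hη, fun k hk j hj => ?_⟩
    obtain rfl : j = 0 := by omega
    simpa using hk
  | succ m ih =>
    obtain ⟨η₁, hη₁, h₁⟩ := ih
    obtain ⟨η₂, hη₂, h₂⟩ := hunif η₁ hη₁
    refine ⟨min η η₂, lt_min hη hη₂, fun k hk j hj => ?_⟩
    rcases j with _ | j
    · simpa using hk.trans_le (min_le_left _ _)
    · have h3 := h₂ (ζ k) (hζ k).1 (ζ' k) (hζ' k).1
        (by rw [dist_eq_norm]; exact hk.trans_le (min_le_right _ _))
      rw [← (hζ k).2, ← (hζ' k).2, dist_eq_norm] at h3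
      have h4 := h₁ (k + 1) h3 j (by omega)
      rwa [show k + 1 + (j : ℤ) = k + ((j + 1 : ℕ) : ℤ) by push_cast; ring] at h4

theorem SeqProximal.exists_norm_sub_lt (h : SeqProximal ζ ζ') {R : ℝ}
    (hR : ∀ k, ‖ζ k - ζ' k‖ ≤ R) {η : ℝ} (hη : 0 < η) : ∃ k, ‖ζ k - ζ' k‖ < η := by
  -- A real `liminf` is informative only under a bound, here `R`.
  have hb : IsBoundedUnder (· ≤ ·) (atTop : Filter ℤ) fun k => ‖ζ k - ζ' k‖ :=
    isBoundedUnder_of ⟨R, hR⟩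
  exact (frequently_lt_of_liminf_lt hb.isCoboundedUnder_ge (h.trans_lt hη)).exists

end Sequences

/-! ### Proximality of the bounded solutions. -/

namespace IntervalTimeScale

theorem ContractionEstimate.proximal {T : IntervalTimeScale} {n : ℕ}
    {A : Matrix (Fin n) (Fin n) ℝ}
    {f : ℝ → EuclideanSpace ℝ (Fin n) → EuclideanSpace ℝ (Fin n)} {L : ℝ}
    (S : T.ContractionEstimate A L)
    (hL : ∀ t ∈ T.carrier, ∀ y₁ y₂, ‖f t y₁ - f t y₂‖ ≤ L * ‖y₁ - y₂‖)
    {ζ ζ' : ℤ → EuclideanSpace ℝ (Fin n)} {y z : ℝ → EuclideanSpace ℝ (Fin n)}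
    (hy : T.IsBoundedSolution A f ζ y) (hz : T.IsBoundedSolution A f ζ' z)
    (hnear : ∀ (m : ℕ) (η : ℝ), 0 < η →
      ∃ k : ℤ, ∀ j : ℕ, j ≤ m → ‖ζ (k + j) - ζ' (k + j)‖ < η) :
    T.Proximal y z := by
  obtain ⟨hy, K, hK⟩ := hy
  obtain ⟨hz, K', hK'⟩ := hz
  have hKK : ∀ t ∈ T.carrier, ‖y t - z t‖ ≤ K + K' := fun t ht =>
    norm_sub_le_of_le (hK t ht) (hK' t ht)
  have hC := S.C_pos
  have hKK0 : 0 ≤ K + K' := (norm_nonneg _).trans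
    (hKK _ (T.Icc_subset_carrier 0 (left_mem_Icc.2 (T.θ_left_lt 0).le)))
  have hκ : 0 < 1 - S.κ := sub_pos.2 S.κ_lt_one
  intro ε hε E
  have hlim : Tendsto (fun m : ℕ => S.C * (S.κ ^ m * (S.C * (K + K')))) atTop (𝓝 0) := by
    simpa using ((tendsto_pow_atTop_nhds_zero_of_lt_one S.κ_pos.le S.κ_lt_one).mul_const
      (S.C * (K + K'))).const_mul S.C
  -- `J` intervals reduce the initial difference, of size at most `K + K'`, to below `ε / 2`; `Q` is
  -- the factor with which the forcing difference enters.
  obtain ⟨J, hJ⟩ := (hlim.eventually_lt_const (half_pos hε)).exists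
  obtain ⟨Q, hQ⟩ : ∃ Q, Q = S.C * (S.C / (1 - S.κ) + 1) := ⟨_, rfl⟩
  have hQ0 : 0 < Q := by rw [hQ]; positivity
  obtain ⟨k, hk⟩ := hnear (J + E) (ε / 2 / Q) (by positivity)
  -- The window starts `J` intervals after the sequences become close, so each of its intervals has
  -- index `k + m` with `J ≤ m ≤ J + E`.
  refine ⟨k + J, fun t ht => ?_⟩
  obtain ⟨i, hi⟩ := mem_iUnion.1 ht.2
  have h1 := T.strictMono.le_iff_le.1 (ht.1.1.trans hi.2)
  have h2 := T.strictMono.le_iff_le.1 (hi.1.trans ht.1.2)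
  obtain ⟨m, hm⟩ := Int.eq_ofNat_of_zero_le (show 0 ≤ i - k by omega)
  obtain rfl : i = k + m := by omega
  have h3 := S.norm_sub_le hL hy hz hKK (η := ε / 2 / Q) (fun j hj => (hk j (by omega)).le) hi
  have h4 : S.κ ^ m ≤ S.κ ^ J := pow_le_pow_of_le_one S.κ_pos.le S.κ_lt_one.le (by omega)
  calc ‖y t - z t‖ ≤ _ := h3
    _ = S.C * (S.κ ^ m * (S.C * (K + K'))) + Q * (ε / 2 / Q) := by rw [hQ]; ring
    _ ≤ S.C * (S.κ ^ J * (S.C * (K + K'))) + Q * (ε / 2 / Q) := by gcongr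
    _ < ε / 2 + ε / 2 := by
      rw [mul_div_cancel₀ _ hQ0.ne']
      linarith
    _ = ε := by ring

end IntervalTimeScale
end

theorem mainTheorem2 {n : ℕ}
    -- the time scale, its period `ω` and the number `p` of intervals per period
    (T : IntervalTimeScale) (ω : ℝ) (hω : 0 < ω) (hT : T.OmegaProperty ω)
    (p : ℕ) (hp : T.IsPeriodCount ω p)
    -- the data of the equation
    (A : Matrix (Fin n) (Fin n) ℝ)
    (f : ℝ → EuclideanSpace ℝ (Fin n) → EuclideanSpace ℝ (Fin n))
    (hf : RdContinuous T.carrier f)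
    (Λ : Set (EuclideanSpace ℝ (Fin n))) (hΛ : IsCompact Λ)
    (F : EuclideanSpace ℝ (Fin n) → EuclideanSpace ℝ (Fin n))
    (hFmaps : MapsTo F Λ Λ) (hFcont : ContinuousOn F Λ)
    -- (C1)
    (C1 : ∀ k : ℤ, (1 + T.δ k • A).det ≠ 0)
    -- (C2)
    (C2 : ∀ μ ∈ spectrum ℂ
      ((NormedSpace.exp (T.ψ ω • A) * T.impulseProd A (Finset.Ico 0 (p : ℤ))).map
        (algebraMap ℝ ℂ)), ‖μ‖ < 1)
    -- (C3)
    (M_f M_F : ℝ) (hM_f : 0 < M_f) (hM_F : 0 < M_F)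
    (C3f : ∀ t ∈ T.carrier, ∀ y, ‖f t y‖ ≤ M_f) (C3F : ∀ η ∈ Λ, ‖F η‖ ≤ M_F)
    -- (C4)
    (L_f : ℝ) (hL_f : 0 < L_f)
    (C4 : ∀ t ∈ T.carrier, ∀ y₁ y₂, ‖f t y₁ - f t y₂‖ ≤ L_f * ‖y₁ - y₂‖)
    -- the exponential bound of the transition matrix, in the induced Euclidean norm
    (N lam : ℝ) (hN : 0 < N) (hlam : 0 < lam)
    (hX : ∀ s r : ℝ, r ≤ s →
      ‖Matrix.toEuclideanCLM (𝕜 := ℝ) (T.transition A s r)‖ ≤ N * Real.exp (-lam * (s - r)))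
    -- (C5)
    (C5 : N * L_f * (1 / lam + p * T.δmax p / (1 - Real.exp (-lam * T.ψ ω))) < 1)
    -- (C6)
    (C6 : -lam + N * L_f + p / T.ψ ω * Real.log (1 + N * L_f * T.δmax p) < 0)
    -- a proximal pair of generated sequences
    (ζ ζ' : ℤ → EuclideanSpace ℝ (Fin n))
    (hζ : ζ ∈ generatedSeqs F Λ) (hζ' : ζ' ∈ generatedSeqs F Λ)
    (hprox : SeqProximal ζ ζ') :
    ∃ φ φ' : ℝ → EuclideanSpace ℝ (Fin n),
      T.IsUniqueBoundedSolution A f ζ φ ∧ T.IsUniqueBoundedSolution A f ζ' φ' ∧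
      T.Proximal φ φ' := by
  obtain ⟨S⟩ := hp.nonempty_contractionEstimate hω hN hlam hL_f hX C6
  obtain ⟨R, hR⟩ := hΛ.isBounded.exists_norm_le
  have hζR (k) : ‖ζ k‖ ≤ R := hR _ (hζ k).1
  have hζR' (k) : ‖ζ' k‖ ≤ R := hR _ (hζ' k).1
  obtain ⟨φ, hφ⟩ := S.exists_isUniqueBoundedSolution hL_f.le hf C3f hM_f.le C4 hζR
  obtain ⟨φ', hφ'⟩ := S.exists_isUniqueBoundedSolution hL_f.le hf C3f hM_f.le C4 hζR'
  refine ⟨φ, φ', hφ, hφ', S.proximal C4 hφ.1 hφ'.1 fun m η hη => ?_⟩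
  obtain ⟨η₀, hη₀, h⟩ := exists_forall_le_norm_sub_lt hΛ hFcont hζ hζ' m hη
  obtain ⟨k, hk⟩ := hprox.exists_norm_sub_lt
    (fun k => norm_sub_le_of_le (hζR k) (hζR' k)) hη₀
  exact ⟨k, h k hk⟩
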